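/- **Setting.** Let $d\in\mathbb N$, $H_{\mathbb C}=L^2(\mathbb R^d\to\mathbb C;dx)$, and let $\hat k\in L^1(\mathbb R^d)$ satisfy $0\le\hat k\le1$ almost everywhere. Let $\mathcal F$ be the unitary Fourier transform $\mathcal Ff(\lambda)=(2\pi)^{-d/2}\int e^{-ix\cdot\lambda}f(x)\,dx$, and let $K=\mathcal F^{-1}\hat k\,\mathcal F$ (so $0\le K\le 1$), $K_1=K^{1/2}$, $K_2=(1-K)^{1/2}$. Put $\varkappa_1=(2\pi)^{-d/2}\mathcal F^{-1}(\hat k^{1/2})\in L^2$ and $\varkappa_{1,x}=\varkappa_1(\cdot-x)$, so that $K_1h(x)=(\varkappa_{1,x},h)$, and let $\varkappa_{2,x}$ be the tempered distribution with $\langle\varkappa_{2,x},h\rangle=(K_2h)(x)$ for complex-valued Schwartz functions $h$. (Scalar products are antilinear in the first argument.) Let $\mathcal F_{\mathrm a}=\bigoplus_{n\ge0}(H_{\mathbb C}\oplus H_{\mathbb C})^{\wedge n}$ be the antisymmetric Fock space over $H_{\mathbb C}\oplus H_{\mathbb C}$, with vacuum $\Omega=(1,0,0,\dots)$, and let $\mathcal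 F_{\mathrm{a,fin}}$ be the space of its finite-particle vectors with the topology of the topological direct sum of the $n$-particle spaces. Let $\mathcal F_{\mathrm{a,fin}}(\Phi)$ be the subspace of finite sequences of antisymmetric Schwartz functions. Let $a_i,a_i^*$ ($i=1,2$) be the standard annihilation and creation operators associated with the $i$-th copy of $H_{\mathbb C}$, and for $x\in\mathbb R^d$ set $\psi(x)=a_2(\varkappa_{2,x})+a_1^*(\overline{\varkappa_{1,x}})$ on $\mathcal F_{\mathrm{a,fin}}(\Phi)$, with dual $\psi^*(x)$, so that the particle density $\rho_{\mathrm a}(x)=\psi^*(x)\psi(x)$ satisfies $\langle\rho_{\mathrm a}(x)G_1,G_2\rangle=(\psi(x)G_1,\psi(x)G_2)_{\mathcal F_{\mathrm a}}$ for $G_1,G_2\in\mathcal F_{\mathrm{a,fin}}(\Phi)$. For a real-valued Schwartz function $f\in S(\mathbb R^d)$ let $\rho_{\mathrm a}(f)=\int f(x)\rho_{\mathrm a}(x)\,dx$ be the continuous linear operator on $\mathcal F_{\mathrm{a,fin}}$ such that $$(\rho_{\mathrm a}(f)G_1,G_2)_{\mathcal F_{\mathrm a}}=\int_{\mathbb R^d}f(x)\,\langle\rho_{\mathrm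 a}(x)G_1,G_2\rangle\,dx\qquad\text{for all }G_1,G_2\in\mathcal F_{\mathrm{a,fin}}(\Phi),$$ the integral being absolutely convergent. Let $\mathfrak H_{\mathrm a}$ be the closure in $\mathcal F_{\mathrm a}$ of the linear span of $\Omega$ and all vectors $\rho_{\mathrm a}(f_1)\cdots\rho_{\mathrm a}(f_n)\Omega$ with $n\ge1$ and $f_1,\dots,f_n\in S(\mathbb R^d)$, and let $\mathfrak H_{\mathrm{a,fin}}=\mathfrak H_{\mathrm a}\cap\mathcal F_{\mathrm{a,fin}}$. **Lemma.** For each $f\in S(\mathbb R^d)$ the operator $\rho_{\mathrm a}(f)$ is well defined, that is, there is exactly one continuous linear operator on $\mathcal F_{\mathrm{a,fin}}$ with the stated property; it maps $\mathfrak H_{\mathrm{a,fin}}$ into $\mathfrak H_{\mathrm a}$; and, as an operator in $\mathfrak H_{\mathrm a}$ with domain $\mathfrak H_{\mathrm{a,fin}}$, it is essentially self-adjoint: it is densely defined and symmetric, and its closure is self-adjoint. -/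

import Mathlib

open MeasureTheory Filter Topology
open scoped ENNReal FourierTransform SchwartzMap ComplexConjugate

noncomputable section

namespace FermiGas

/-- Position space `ℝ^d` with its Euclidean structure and Lebesgue measure. -/
abbrev Space (d : ℕ) : Type := EuclideanSpace ℝ (Fin d)

/-! ### The antisymmetric Fock space over `H ⊕ H`, `H = L²(ℝ^d)`

`H_ℂ ⊕ H_ℂ` is `L²({0, 1} × ℝ^d)`, where the label `0` stands for the first copy of `H` and the
label `1` for the second one. Its `n`-th Hilbert tensor power is
`L²(({0, 1} × ℝ^d)^n)`: families, indexed by `s ∈ {0, 1}^n`, of elements of `L²((ℝ^d)^n)`. -/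

/-- The `n`-th Hilbert tensor power of `H_ℂ ⊕ H_ℂ`. -/
abbrev TensorPow (d n : ℕ) : Type :=
  PiLp 2 (fun _ : Fin n → Fin 2 => Lp ℂ 2 (volume : Measure (Fin n → Space d)))

/-- Permuting the `n` particles preserves Lebesgue measure. -/
theorem measurePreserving_perm (d : ℕ) {n : ℕ} (π : Equiv.Perm (Fin n)) :
    MeasurePreserving (fun y : Fin n → Space d => y ∘ π) volume volume := by
  have h := volume_measurePreserving_piCongrLeft (fun _ : Fin n => Space d) π.symm
  convert h using 1
  ext y i
  simp [MeasurableEquiv.piCongrLeft, Equiv.piCongrLeft, Equiv.piCongrLeft']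

/-- The element `(s, y) ↦ G (s ∘ π, y ∘ π)` of the `n`-th tensor power, evaluated at `s`. -/
def permute {d n : ℕ} (π : Equiv.Perm (Fin n)) (G : TensorPow d n) (s : Fin n → Fin 2) :
    Lp ℂ 2 (volume : Measure (Fin n → Space d)) :=
  Lp.compMeasurePreserving (fun y : Fin n → Space d => y ∘ π) (measurePreserving_perm d π)
    (G (s ∘ π))

/-- The `n`-particle space `(H_ℂ ⊕ H_ℂ)^{∧ n}`: the elements `G` of the tensor power with
`G (s ∘ π, y ∘ π) = sign π * G (s, y)` for all permutations `π` of the particles. -/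
def antisymm (d n : ℕ) : Submodule ℂ (TensorPow d n) where
  carrier := {G | ∀ (π : Equiv.Perm (Fin n)) (s : Fin n → Fin 2),
    permute π G s = ((Equiv.Perm.sign π : ℤ) : ℂ) • G s}
  zero_mem' := by
    intro π s
    simp [permute]
  add_mem' := by
    intro a b ha hb π s
    have h1 := ha π s
    have h2 := hb π s
    simp only [permute, PiLp.add_apply, map_add, smul_add] at *
    rw [h1, h2]
  smul_mem' := by
    intro c a ha π s
    have h1 := ha π s
    simp only [permute, PiLp.smul_apply] at *
    rw [smul_comm, ← h1]
    apply Lp.ext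
    have hp := measurePreserving_perm d π
    refine (Lp.coeFn_compMeasurePreserving _ hp).trans ?_
    refine (hp.quasiMeasurePreserving.ae_eq_comp (Lp.coeFn_smul c (a (s ∘ π)))).trans ?_
    filter_upwards [Lp.coeFn_smul c
      (Lp.compMeasurePreserving (fun y : Fin n → Space d => y ∘ π) hp (a (s ∘ π))),
      Lp.coeFn_compMeasurePreserving (a (s ∘ π)) hp] with y hy hy'
    rw [hy, Pi.smul_apply, hy']
    rfl

theorem isClosed_antisymm (d n : ℕ) : IsClosed (antisymm d n : Set (TensorPow d n)) := by
  have h : (antisymm d n : Set (TensorPow d n)) =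
      ⋂ (π : Equiv.Perm (Fin n)) (s : Fin n → Fin 2),
        {G | permute π G s = ((Equiv.Perm.sign π : ℤ) : ℂ) • G s} := by
    ext G
    simp [antisymm]
  rw [h]
  refine isClosed_iInter fun π => isClosed_iInter fun s => isClosed_eq ?_ ?_
  · exact (Lp.isometry_compMeasurePreserving (measurePreserving_perm d π)).continuous.comp
      (PiLp.continuous_apply 2
        (fun _ : Fin n → Fin 2 => Lp ℂ 2 (volume : Measure (Fin n → Space d))) (s ∘ π))
  · have h2 : Continuous fun G : TensorPow d n => G s := PiLp.continuous_apply 2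
      (fun _ : Fin n → Fin 2 => Lp ℂ 2 (volume : Measure (Fin n → Space d))) s
    exact h2.const_smul ((Equiv.Perm.sign π : ℤ) : ℂ)

instance instCompleteSpaceAntisymm (d n : ℕ) : CompleteSpace (antisymm d n) :=
  (isClosed_antisymm d n).completeSpace_coe

/-- The antisymmetric Fock space over `H ⊕ H`: the Hilbert direct sum of the `n`-particle
spaces. -/
abbrev Fock (d : ℕ) : Type := lp (fun n : ℕ => antisymm d n) 2

/-- Finite-particle vectors: those with `u n = 0` for all large `n`. -/
def fockFin (d : ℕ) : Submodule ℂ (Fock d) where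
  carrier := {u | ∃ N : ℕ, ∀ n, N ≤ n → u n = 0}
  zero_mem' := ⟨0, fun _ _ => rfl⟩
  add_mem' := by
    rintro a b ⟨N, hN⟩ ⟨M, hM⟩
    refine ⟨max N M, fun n hn => ?_⟩
    rw [lp.coeFn_add, Pi.add_apply, hN n (le_trans (le_max_left _ _) hn),
      hM n (le_trans (le_max_right _ _) hn), add_zero]
  smul_mem' := by
    rintro c a ⟨N, hN⟩
    refine ⟨N, fun n hn => ?_⟩
    rw [lp.coeFn_smul, Pi.smul_apply, hN n hn, smul_zero]

/-! ### Test vectors -/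

/-- Finite sequences of antisymmetric Schwartz functions of `n` particles: the finite-particle
vectors over `Φ = S_ℂ(ℝ^d) ⊕ S_ℂ(ℝ^d)`. -/
structure TestVector (d : ℕ) where
  /-- The component with `n` particles and labels `s`. -/
  toFun : ∀ n : ℕ, (Fin n → Fin 2) → 𝓢(Fin n → Space d, ℂ)
  antisymm' : ∀ (n : ℕ) (π : Equiv.Perm (Fin n)) (s : Fin n → Fin 2) (y : Fin n → Space d),
    toFun n (s ∘ π) (y ∘ π) = ((Equiv.Perm.sign π : ℤ) : ℂ) * toFun n s y
  finite' : ∃ N : ℕ, ∀ n, N ≤ n → toFun n = 0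

instance instHasTemperateGrowthPi (d n : ℕ) :
    (volume : Measure (Fin n → Space d)).HasTemperateGrowth :=
  haveI h : (volume : Measure (Fin n → Space d)).IsAddHaarMeasure := inferInstance
  @Measure.IsAddHaarMeasure.instHasTemperateGrowth _ _ _ _ _ _ _ h

namespace TestVector

variable {d : ℕ}

/-- The `n`-particle component of a test vector, as an element of the `n`-particle space. -/
def component (G : TestVector d) (n : ℕ) : antisymm d n :=
  ⟨WithLp.toLp 2 fun s => (G.toFun n s).toLp 2 volume, by
    intro π s
    apply Lp.ext
    have hp := measurePreserving_perm d π
    have h1 : permute π (WithLp.toLp 2 fun s => (G.toFun n s).toLp 2 volume) s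
        =ᵐ[volume] fun y => G.toFun n (s ∘ π) (y ∘ π) := by
      refine (Lp.coeFn_compMeasurePreserving _ hp).trans ?_
      exact hp.quasiMeasurePreserving.ae_eq_comp (SchwartzMap.coeFn_toLp (G.toFun n (s ∘ π)) 2)
    refine h1.trans ?_
    filter_upwards [Lp.coeFn_smul ((Equiv.Perm.sign π : ℤ) : ℂ) ((G.toFun n s).toLp 2 volume),
      SchwartzMap.coeFn_toLp (G.toFun n s) 2] with y hy hy'
    rw [G.antisymm' n π s y, ← hy']
    exact hy.symm⟩

theorem component_eq_zero (G : TestVector d) {n : ℕ} (h : G.toFun n = 0) :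
    G.component n = 0 := by
  apply Subtype.ext
  ext1 s
  change (G.toFun n s).toLp 2 volume = 0
  rw [h]
  exact map_zero (SchwartzMap.toLpCLM ℂ ℂ 2 (volume : Measure (Fin n → Space d)))

theorem memlp_component (G : TestVector d) :
    Memℓp (E := fun n : ℕ => antisymm d n) (fun n => G.component n) 2 := by
  obtain ⟨N, hN⟩ := G.finite'
  have h0 : Memℓp (E := fun n : ℕ => antisymm d n) (fun n => G.component n) 0 := by
    refine memℓp_zero ((Set.finite_lt_nat N).subset fun n hn => ?_)
    by_contra hlt
    exact hn (G.component_eq_zero (hN n (not_lt.mp hlt)))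
  exact h0.of_exponent_ge zero_le

/-- A test vector as a finite-particle vector of the Fock space. -/
def toFock (G : TestVector d) : fockFin d :=
  ⟨⟨fun n => G.component n, G.memlp_component⟩, by
    obtain ⟨N, hN⟩ := G.finite'
    exact ⟨N, fun n hn => G.component_eq_zero (hN n hn)⟩⟩

end TestVector

/-- The test vector `(1, 0, 0, …)`. -/
def vacuumTest (d : ℕ) : TestVector d where
  toFun n _ :=
    if h : n = 0 then
      { toFun := fun _ => 1
        smooth' := contDiff_const
        decay' := by
          subst h
          intro k m
          refine ⟨1 * ‖iteratedFDeriv ℝ m (fun _ : Fin 0 → Space d => (1 : ℂ)) 0‖, fun x => ?_⟩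
          rw [Subsingleton.elim x 0, norm_zero]
          exact mul_le_mul_of_nonneg_right (pow_le_one₀ le_rfl zero_le_one) (norm_nonneg _) }
    else 0
  antisymm' := by
    intro n π s y
    by_cases h : n = 0
    · subst h
      rw [Subsingleton.elim π 1]
      simp
    · simp [h]
  finite' := ⟨1, fun n hn => by
    funext s
    have h : n ≠ 0 := by omega
    simp [h]⟩

/-- The vacuum vector `Ω = (1, 0, 0, …)`. -/
def vacuum (d : ℕ) : fockFin d := (vacuumTest d).toFock

/-! ### Field operators and particle densities

`khat` is the density distribution in momentum space and `K = 𝓕⁻¹ khat 𝓕` for the unitary Fourier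
transform `(2π)^{-d/2} ∫ exp (-i x · λ) f x dx`. Mathlib's Fourier transform has the kernel
`exp (-2πi x · ξ)`, so that the momentum is `λ = 2π ξ`: multiplication by `m (λ)` in momentum space
is multiplication by `m (2π ξ)` after Mathlib's Fourier transform. -/

section Field

variable {d : ℕ}

theorem memLp_sqrt (khat : Space d → ℝ) (hk : Integrable khat volume) :
    MemLp (fun ξ => ((√(khat ((2 * Real.pi) • ξ)) : ℝ) : ℂ)) 2 volume := by
  have hk' : Integrable (fun ξ => khat ((2 * Real.pi) • ξ)) volume :=
    hk.comp_smul (by positivity)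
  have hm : AEStronglyMeasurable (fun ξ => ((√(khat ((2 * Real.pi) • ξ)) : ℝ) : ℂ)) volume :=
    (Complex.continuous_ofReal.comp Real.continuous_sqrt).comp_aestronglyMeasurable
      hk'.aestronglyMeasurable
  rw [memLp_two_iff_integrable_sq_norm hm]
  refine hk'.mono (hm.norm.pow 2) (Eventually.of_forall fun ξ => ?_)
  rw [Complex.norm_real, norm_pow, norm_norm, Real.norm_eq_abs, sq_abs, Real.norm_eq_abs]
  by_cases h : 0 ≤ khat ((2 * Real.pi) • ξ)
  · rw [Real.sq_sqrt h]
    exact le_abs_self _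
  · rw [Real.sqrt_eq_zero_of_nonpos (not_le.mp h).le]
    simp

/-- `ϰ₁ = (2π)^{-d/2} 𝓕⁻¹ (khat^{1/2})`, an element of `L²`, so that `K^{1/2} f = ϰ₁ * f`. After
the substitution `λ = 2π ξ` it is Mathlib's inverse `L²` Fourier transform of
`ξ ↦ khat (2π ξ)^{1/2}`. -/
def kappaOne (khat : Space d → ℝ) (hk : Integrable khat volume) :
    Lp ℂ 2 (volume : Measure (Space d)) :=
  𝓕⁻ ((memLp_sqrt khat hk).toLp _)

/-- `⟨ϰ_{2,x}, h⟩ = ((1 - K)^{1/2} h) (x)` for a Schwartz function `h`; the inverse Fourier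
integral converges absolutely. -/
def pairKappaTwo (khat : Space d → ℝ) (x : Space d) (h : Space d → ℂ) : ℂ :=
  𝓕⁻ (fun ξ : Space d => ((√(1 - khat ((2 * Real.pi) • ξ)) : ℝ) : ℂ) * 𝓕 h ξ) x

/-- The annihilation operator `a₂(ϰ_{2,x})` on test vectors: it pairs one of the `n + 1` particles,
taken from the second copy of `H`, with `ϰ_{2,x}` and multiplies by `√(n + 1)`. -/
def annihilateTwo (khat : Space d → ℝ) (x : Space d) (G : TestVector d) (n : ℕ)
    (s : Fin n → Fin 2) (y : Fin n → Space d) : ℂ :=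
  (√((n : ℝ) + 1) : ℝ) *
    pairKappaTwo khat x fun z =>
      G.toFun (n + 1) (Fin.cons (1 : Fin 2) s : Fin (n + 1) → Fin 2)
        (Fin.cons z y : Fin (n + 1) → Space d)

/-- The creation operator `a₁*(conj ϰ_{1,x})` on test vectors, where `ϰ_{1,x} = ϰ₁ (· - x)`: the
component with `n + 1` particles is `√(n + 1)` times the antisymmetrization of the tensor product
of `(conj ϰ_{1,x}, 0)` and the `n`-particle component. -/
def createOne (khat : Space d → ℝ) (hk : Integrable khat volume) (x : Space d)
    (G : TestVector d) : ∀ n : ℕ, (Fin n → Fin 2) → (Fin n → Space d) → ℂ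
  | 0, _, _ => 0
  | n + 1, s, y =>
    ((1 / √((n : ℝ) + 1) : ℝ) : ℂ) *
      ∑ i : Fin (n + 1), (-1 : ℂ) ^ (i : ℕ) *
        (if s i = 0 then conj (kappaOne khat hk (y i - x)) else 0) *
          G.toFun n (s ∘ i.succAbove) (y ∘ i.succAbove)

/-- The field operator `ψ(x) = a₂(ϰ_{2,x}) + a₁*(conj ϰ_{1,x})` on test vectors, as a sequence of
square integrable functions. -/
def fieldOp (khat : Space d → ℝ) (hk : Integrable khat volume) (x : Space d)
    (G : TestVector d) (n : ℕ) (s : Fin n → Fin 2) (y : Fin n → Space d) : ℂ :=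
  annihilateTwo khat x G n s y + createOne khat hk x G n s y

/-- `⟨ρ(x) G₁, G₂⟩` for the particle density `ρ(x) = ψ*(x) ψ(x)` and test vectors `G₁`, `G₂`. As
`ψ*(x) = a₂*(ϰ_{2,x}) + a₁(conj ϰ_{1,x})` maps finite-particle vectors to functionals on test
vectors and is dual to `ψ(x)`, this is the scalar product of `ψ(x) G₁` and `ψ(x) G₂` in the Fock
space. Only finitely many terms of the sum are not zero. -/
def densityForm (khat : Space d → ℝ) (hk : Integrable khat volume) (x : Space d)
    (G₁ G₂ : TestVector d) : ℂ :=
  ∑' n : ℕ, ∑ s : Fin n → Fin 2, ∫ y : Fin n → Space d,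
    conj (fieldOp khat hk x G₁ n s y) * fieldOp khat hk x G₂ n s y

/-- Continuity of a linear operator on the finite-particle vectors in the topology of the direct
sum of the Banach spaces of `n`-particle vectors (uniform finiteness and coordinatewise
convergence): vectors with fewer than `N` particles go to vectors with fewer than `M` particles,
boundedly. -/
def IsFinContinuous (R : Module.End ℂ (fockFin d)) : Prop :=
  ∀ N : ℕ, ∃ (M : ℕ) (C : ℝ), ∀ u : fockFin d, (∀ n, N ≤ n → (u : Fock d) n = 0) →
    (∀ n, M ≤ n → (R u : Fock d) n = 0) ∧ ‖(R u : Fock d)‖ ≤ C * ‖(u : Fock d)‖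

/-- `R` is the smeared particle density `∫ f(x) ρ(x) dx`: a continuous operator on the
finite-particle vectors with `⟨R G₁, G₂⟩ = ∫ f(x) ⟨ρ(x) G₁, G₂⟩ dx` for all test vectors, the
integral being absolutely convergent. -/
def IsSmearedDensity (khat : Space d → ℝ) (hk : Integrable khat volume) (f : 𝓢(Space d, ℝ))
    (R : Module.End ℂ (fockFin d)) : Prop :=
  IsFinContinuous R ∧ ∀ G₁ G₂ : TestVector d,
    Integrable (fun x => (f x : ℂ) * densityForm khat hk x G₁ G₂) volume ∧
    inner ℂ (R G₁.toFock : Fock d) (G₂.toFock : Fock d) =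
      ∫ x, (f x : ℂ) * densityForm khat hk x G₁ G₂

/-- The fermionic density operator `ρ_a(f) = ∫ f(x) ρ(x) dx` on the finite-particle vectors: the
operator singled out by `IsSmearedDensity`. -/
def density (khat : Space d → ℝ) (hk : Integrable khat volume) (f : 𝓢(Space d, ℝ)) :
    Module.End ℂ (fockFin d) :=
  Classical.epsilon (IsSmearedDensity khat hk f)

/-- The Hilbert space `𝔥_a`: the closure of the linear span of `Ω` and all vectors
`ρ_a(f₁) ⋯ ρ_a(fₙ) Ω`. -/
def cyclicSpace (khat : Space d → ℝ) (hk : Integrable khat volume) : Submodule ℂ (Fock d) :=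
  (Submodule.span ℂ (Set.range fun l : List 𝓢(Space d, ℝ) =>
    (((l.map (density khat hk)).prod (vacuum d) : fockFin d) : Fock d))).topologicalClosure

instance instCompleteSpaceCyclicSpace (khat : Space d → ℝ) (hk : Integrable khat volume) :
    CompleteSpace (cyclicSpace khat hk) :=
  (Submodule.isClosed_topologicalClosure _).completeSpace_coe

/-- `𝔥_{a,fin}`: the finite-particle vectors in `𝔥_a`, as a subspace of `𝔥_a`. -/
def cyclicFin (khat : Space d → ℝ) (hk : Integrable khat volume) :
    Submodule ℂ (cyclicSpace khat hk) :=
  (fockFin d).comap (cyclicSpace khat hk).subtype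

end Field

/-- An operator in a Hilbert space is essentially self-adjoint if it is densely defined, symmetric,
and its closure is self-adjoint. -/
def IsEssentiallySelfAdjoint {F : Type*} [NormedAddCommGroup F] [InnerProductSpace ℂ F]
    [CompleteSpace F] (T : F →ₗ.[ℂ] F) : Prop :=
  Dense (T.domain : Set F) ∧ T.IsFormalAdjoint T ∧ IsSelfAdjoint T.closure

end FermiGas

end

/-! The density is a difference of two positive quadratic expressions in the field. With `w = √(max
f 0)`, and likewise for `-f`, the map `x ↦ w(x) ψ(x)` gives for each `n` a bounded operator `Φₙ`
from the Fock space to square integrable functions of `x` and `n` particles. The annihilation part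
is bounded because `w` is bounded and multiplication by `√(1 - khat)` is a contraction in momentum
space. The creation part is bounded because both `w` and `ϰ₁` are square integrable. Both parts have
norm of order `√(n + 1)`, and `Φₙ` sees only the components with `n + 1` and `n - 1` particles.
Hence `∑ Φₙ* Φₙ` acts on finite-particle vectors, is symmetric, raises the particle number by at
most two, and has norm `O(N)` on vectors with fewer than `N` particles. By Fubini its matrix
elements between test vectors are the required integrals (`exists_isSmearedDensity`). Uniqueness
follows because antisymmetrized Schwartz functions are total in every `n`-particle space.

The linear growth yields `‖ρ(f)ᵏ u‖ ≤ C Mᵏ k!`, so every finite-particle vector is analytic for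
`ρ(f)`. Essential self-adjointness then follows from Nelson's theorem
(`isEssentiallySelfAdjoint_of_analyticVectors`), proved here by iterating the power series of
`exp(itT)` on sequences `Tⁿ u`.

The invariance claim needs an argument of its own, since `𝔥_a ∩ 𝓕_fin` may be larger than the span
`W` of the cyclic vectors, and only `W` is obviously invariant. Nelson's theorem on `W` shows that
the adjoint of `ρ(f)|W` in `𝔥_a` is the closure of `ρ(f)|W`. For `x` in `𝔥_a ∩ 𝓕_fin` and `P` the
projection onto `𝔥_a`, symmetry puts `(x, P ρ(f) x)` in the graph of that adjoint, hence in the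
closure of the graph. Pairing with arbitrary finite-particle vectors, which are dense, forces `P
ρ(f) x = ρ(f) x` (`exists_essentiallySelfAdjoint_restriction`). -/

noncomputable section

namespace FermiGas

/-! ### Nelson's analytic vector theorem -/

section Nelson

open Nat

variable {F : Type*} [NormedAddCommGroup F] [InnerProductSpace ℂ F]

/-- The sequence `a` behaves like the sequence of powers `Sⁿ u` of a symmetric operator `S` at a
vector `u` that is analytic for `S`. -/
structure IsAnalyticSeq (C M : ℝ) (a : ℕ → F) : Prop where
  symm : ∀ m n, inner ℂ (a (m + 1)) (a n) = inner ℂ (a m) (a (n + 1))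
  bound : ∀ n, ‖a n‖ ≤ C * M ^ n * (n ! : ℝ)

/-- The coefficients of the exponential series `exp (i t)`. -/
def expCoeff (t : ℝ) (k : ℕ) : ℂ := (Complex.I * t) ^ k / (k ! : ℂ)

theorem norm_expCoeff (t : ℝ) (k : ℕ) : ‖expCoeff t k‖ = |t| ^ k / (k ! : ℝ) := by
  simp [expCoeff]

/-- Up to the factor `1 / j!` this is the binomial expansion of `(-it + it)ʲ`. It is the power
series form of `exp(-it) exp(it) = 1` and carries the unitarity of the flow. -/
theorem sum_antidiagonal_expCoeff (t : ℝ) (j : ℕ) :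
    ∑ p ∈ Finset.HasAntidiagonal.antidiagonal j, conj (expCoeff t p.1) * expCoeff t p.2 =
      if j = 0 then 1 else 0 := by
  have h : ∀ p ∈ Finset.HasAntidiagonal.antidiagonal j, conj (expCoeff t p.1) * expCoeff t p.2 =
      (1 / (j ! : ℂ)) *
        ((j.choose p.1 : ℂ) * ((-(Complex.I * t)) ^ p.1 * (Complex.I * t) ^ p.2)) := by
    intro p hp
    obtain rfl := Finset.HasAntidiagonal.mem_antidiagonal.mp hp
    have h1 : ((p.1 + p.2).choose p.1 : ℂ) = ((p.1 + p.2)! : ℂ) / ((p.1 ! : ℂ) * (p.2 ! : ℂ)) := by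
      rw [Nat.cast_add_choose]
    have h2 : ((p.1 + p.2)! : ℂ) ≠ 0 := by exact_mod_cast Nat.factorial_ne_zero _
    rw [h1]
    simp only [expCoeff, map_div₀, map_pow, map_mul, Complex.conj_I, Complex.conj_ofReal,
      Complex.conj_natCast]
    have h3 : (p.1 ! : ℂ) ≠ 0 := by exact_mod_cast Nat.factorial_ne_zero _
    have h4 : (p.2 ! : ℂ) ≠ 0 := by exact_mod_cast Nat.factorial_ne_zero _
    field_simp
  rw [Finset.sum_congr rfl h, ← Finset.mul_sum]
  have h5 := Commute.add_pow' (Commute.all (-(Complex.I * (t : ℂ))) (Complex.I * t)) j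
  simp only [nsmul_eq_mul] at h5
  rw [← h5, neg_add_cancel]
  by_cases hj : j = 0
  · subst hj; simp
  · simp [hj]

namespace IsAnalyticSeq

variable {C M : ℝ} {a : ℕ → F}

/-- Symmetry moves powers across the scalar product, so the Gram matrix depends only on `m + n`. -/
theorem inner_eq (h : IsAnalyticSeq C M a) (m n : ℕ) :
    inner ℂ (a m) (a n) = inner ℂ (a 0) (a (m + n)) := by
  induction m generalizing n with
  | zero => simp
  | succ m ih => rw [h.symm, ih, show m + (n + 1) = m + 1 + n by ring]

/-- The estimate `(n + k)! ≤ 2ⁿ⁺ᵏ n! k!` gives a geometric series in `k`. This is where the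
condition `2 M |t| < 1` comes from; it does not depend on `n`. -/
theorem norm_term_le (h : IsAnalyticSeq C M a) (hC : 0 ≤ C) (hM : 0 ≤ M) (t : ℝ) (n k : ℕ) :
    ‖expCoeff t k • a (n + k)‖ ≤ C * n ! * (2 * M) ^ n * (2 * M * |t|) ^ k := by
  rw [norm_smul, norm_expCoeff]
  have h1 : ((n + k)! : ℝ) ≤ 2 ^ (n + k) * n ! * k ! := by
    rw [← Nat.add_choose_mul_factorial_mul_factorial n k]
    push_cast
    gcongr
    exact_mod_cast Nat.choose_le_two_pow (n + k) _
  have hk : (0 : ℝ) < k ! := by exact_mod_cast Nat.factorial_pos k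
  calc |t| ^ k / (k ! : ℝ) * ‖a (n + k)‖
      ≤ |t| ^ k / (k ! : ℝ) * (C * M ^ (n + k) * (2 ^ (n + k) * n ! * k !)) := by
        gcongr
        exact (h.bound _).trans (by gcongr)
    _ = C * n ! * (2 * M) ^ n * (2 * M * |t|) ^ k := by
        field_simp
        ring

theorem summable_norm (h : IsAnalyticSeq C M a) (hC : 0 ≤ C) (hM : 0 ≤ M) {t : ℝ}
    (ht : 2 * M * |t| < 1) (n : ℕ) : Summable fun k => ‖expCoeff t k • a (n + k)‖ :=
  Summable.of_nonneg_of_le (fun _ => norm_nonneg _) (fun k => h.norm_term_le hC hM t n k)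
    ((summable_geometric_of_lt_one (by positivity) ht).mul_left _)

variable [CompleteSpace F]

theorem summable (h : IsAnalyticSeq C M a) (hC : 0 ≤ C) (hM : 0 ≤ M) {t : ℝ}
    (ht : 2 * M * |t| < 1) (n : ℕ) : Summable fun k => expCoeff t k • a (n + k) :=
  (h.summable_norm hC hM ht n).of_norm

/-- The unitary flow `exp (i t S)` preserves the scalar products. -/
theorem inner_flow (h : IsAnalyticSeq C M a) (hC : 0 ≤ C) (hM : 0 ≤ M) {t : ℝ}
    (ht : 2 * M * |t| < 1) (m n : ℕ) :
    inner ℂ (∑' k, expCoeff t k • a (m + k)) (∑' k, expCoeff t k • a (n + k)) =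
      inner ℂ (a m) (a n) := by
  set f : ℕ × ℕ → ℂ := fun p =>
    inner ℂ (expCoeff t p.1 • a (m + p.1)) (expCoeff t p.2 • a (n + p.2))
    with hf
  have hs : Summable f := by
    refine Summable.of_norm_bounded
      ((h.summable_norm hC hM ht m).mul_of_nonneg (h.summable_norm hC hM ht n)
        (fun _ => norm_nonneg _) (fun _ => norm_nonneg _)) fun p => norm_inner_le_norm _ _
  have h1 : inner ℂ (∑' k, expCoeff t k • a (m + k)) (∑' k, expCoeff t k • a (n + k)) =
      ∑' p, f p := by
    rw [hs.tsum_prod]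
    have h2 : ∀ v : F, inner ℂ (∑' k, expCoeff t k • a (m + k)) v =
        ∑' k, inner ℂ (expCoeff t k • a (m + k)) v := by
      intro v
      have h3 := ((h.summable hC hM ht m).hasSum.mapL (innerSL ℂ v))
      rw [← inner_conj_symm]
      simp only [innerSL_apply_apply] at h3
      rw [← h3.tsum_eq, Complex.conj_tsum]
      simp only [inner_conj_symm]
    rw [h2]
    refine tsum_congr fun k => ?_
    have h3 := ((h.summable hC hM ht n).hasSum.mapL (innerSL ℂ (expCoeff t k • a (m + k))))
    exact h3.tsum_eq.symm
  -- Resummed along the antidiagonals, the double series has a constant scalar product on each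
  -- diagonal `j`, multiplied by a coefficient sum that vanishes unless `j = 0`.
  have hs' : Summable fun c => f (Finset.HasAntidiagonal.sigmaAntidiagonalEquivProd c) :=
    (Finset.HasAntidiagonal.sigmaAntidiagonalEquivProd).summable_iff.mpr hs
  rw [h1, ← Finset.HasAntidiagonal.sigmaAntidiagonalEquivProd.tsum_eq f,
    hs'.tsum_sigma' (fun j => (hasSum_fintype _).summable), tsum_eq_single 0]
  · simp [hf, Finset.HasAntidiagonal.sigmaAntidiagonalEquivProd, expCoeff]
  · intro j hj
    rw [tsum_fintype]
    have h4 : ∀ p : Finset.HasAntidiagonal.antidiagonal j,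
        f (Finset.HasAntidiagonal.sigmaAntidiagonalEquivProd ⟨j, p⟩) =
        (conj (expCoeff t p.1.1) * expCoeff t p.1.2) * inner ℂ (a 0) (a (m + n + j)) := by
      rintro ⟨p, hp⟩
      obtain rfl := Finset.HasAntidiagonal.mem_antidiagonal.mp hp
      simp only [hf, Finset.HasAntidiagonal.sigmaAntidiagonalEquivProd, Equiv.coe_fn_mk,
        inner_smul_left,
        inner_smul_right]
      rw [h.inner_eq, show m + p.1 + (n + p.2) = m + n + (p.1 + p.2) by ring]
      ring
    rw [Finset.sum_congr rfl fun p _ => h4 p, ← Finset.sum_mul,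
      Finset.sum_coe_sort (Finset.HasAntidiagonal.antidiagonal j)
        (fun p => conj (expCoeff t p.1) * expCoeff t p.2), sum_antidiagonal_expCoeff]
    simp [hj]

/-- The flow preserves norms, so the constants `C` and `M` do not deteriorate and the same time step
can be repeated indefinitely. Working with sequences avoids asking whether the limits lie in the
domain of an operator. -/
theorem flow (h : IsAnalyticSeq C M a) (hC : 0 ≤ C) (hM : 0 ≤ M) {t : ℝ}
    (ht : 2 * M * |t| < 1) :
    IsAnalyticSeq C M fun n => ∑' k, expCoeff t k • a (n + k) where
  symm m n := by
    rw [h.inner_flow hC hM ht, h.inner_flow hC hM ht, h.symm]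
  bound n := by
    have h1 : ‖∑' k, expCoeff t k • a (n + k)‖ = ‖a n‖ := by
      rw [@norm_eq_sqrt_re_inner ℂ, @norm_eq_sqrt_re_inner ℂ F _ _ _ (a n),
        h.inner_flow hC hM ht]
    rw [h1]
    exact h.bound n

theorem inner_flow_eigen (h : IsAnalyticSeq C M a) (hC : 0 ≤ C) (hM : 0 ≤ M) {t : ℝ}
    (ht : 2 * M * |t| < 1) {w : F} {z : ℂ}
    (hw : ∀ n, inner ℂ w (a (n + 1)) = z * inner ℂ w (a n)) (n : ℕ) :
    inner ℂ w (∑' k, expCoeff t k • a (n + k)) =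
      Complex.exp (Complex.I * t * z) * inner ℂ w (a n) := by
  have h1 : ∀ k, inner ℂ w (a (n + k)) = z ^ k * inner ℂ w (a n) := by
    intro k
    induction k with
    | zero => simp
    | succ k ih => rw [← add_assoc, hw, ih]; ring
  have h2 := ((h.summable hC hM ht n).hasSum.mapL (innerSL ℂ w)).tsum_eq
  simp only [innerSL_apply_apply, inner_smul_right, h1] at h2
  rw [← h2, Complex.exp_eq_exp_ℂ, NormedSpace.exp_eq_tsum_div, ← tsum_mul_right]
  refine tsum_congr fun k => ?_
  rw [expCoeff, mul_pow _ z]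
  ring

/-- A vector that behaves like an eigenvector with a nonreal eigenvalue is orthogonal to the
analytic vectors. -/
theorem inner_eq_zero (h : IsAnalyticSeq C M a) (hC : 0 ≤ C) (hM : 0 ≤ M) {w : F} {z : ℂ}
    (hz : z.im ≠ 0) (hw : ∀ n, inner ℂ w (a (n + 1)) = z * inner ℂ w (a n)) :
    inner ℂ w (a 0) = 0 := by
  -- The sign of `t` is chosen so that `|exp(itz)| = exp(-t Im z) > 1`, and its size so that the
  -- series converge.
  obtain ⟨t, ht, htz⟩ : ∃ t : ℝ, 2 * M * |t| < 1 ∧ t * z.im < 0 := by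
    have hp : (0 : ℝ) < 1 / (2 * M + 1) := by positivity
    have hl : 2 * M * |1 / (2 * M + 1)| < 1 := by
      rw [abs_of_pos hp, mul_one_div, div_lt_one (by positivity)]
      linarith
    rcases lt_or_gt_of_ne hz with hz | hz
    · exact ⟨_, hl, mul_neg_of_pos_of_neg hp hz⟩
    · exact ⟨-(1 / (2 * M + 1)), by rwa [abs_neg], mul_neg_of_neg_of_pos (neg_lt_zero.mpr hp) hz⟩
  set q := Complex.exp (Complex.I * t * z) with hq
  have hq1 : 1 < ‖q‖ := by
    rw [hq, Complex.norm_exp, Real.one_lt_exp_iff]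
    simp only [Complex.mul_re, Complex.I_re, Complex.I_im, Complex.ofReal_re, Complex.ofReal_im,
      Complex.mul_im]
    linarith
  -- After `j` time steps the pairing with `w` has grown by `qʲ`, while it stays bounded by `‖w‖ C`;
  -- this is possible only if it was zero.
  have key : ∀ j : ℕ, ∃ b : ℕ → F, IsAnalyticSeq C M b ∧
      (∀ n, inner ℂ w (b (n + 1)) = z * inner ℂ w (b n)) ∧
      inner ℂ w (b 0) = q ^ j * inner ℂ w (a 0) := by
    intro j
    induction j with
    | zero => exact ⟨a, h, hw, by simp⟩
    | succ j ih =>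
      obtain ⟨b, hb, hbw, hb0⟩ := ih
      refine ⟨_, hb.flow hC hM ht, fun n => ?_, ?_⟩
      · rw [hb.inner_flow_eigen hC hM ht hbw, hb.inner_flow_eigen hC hM ht hbw, hbw]
        ring
      · rw [hb.inner_flow_eigen hC hM ht hbw, hb0]
        ring
  by_contra hne
  have hpos : 0 < ‖inner ℂ w (a 0)‖ := norm_pos_iff.mpr hne
  obtain ⟨j, hj⟩ := pow_unbounded_of_one_lt (‖w‖ * C / ‖inner ℂ w (a 0)‖) hq1
  obtain ⟨b, hb, -, hb0⟩ := key j
  have h1 : ‖q‖ ^ j * ‖inner ℂ w (a 0)‖ ≤ ‖w‖ * C := by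
    rw [← norm_pow, ← norm_mul, ← hb0]
    refine (norm_inner_le_norm _ _).trans ?_
    gcongr
    simpa using hb.bound 0
  rw [div_lt_iff₀ hpos] at hj
  linarith

end IsAnalyticSeq

section AnalyticVectors

variable {T : F →ₗ.[ℂ] F}

/-- `u` is an analytic vector for the operator `T`: all powers `Tⁿ u` are defined, and
`‖Tⁿ u‖ ≤ C Mⁿ n!`. -/
def IsAnalyticVector (T : F →ₗ.[ℂ] F) (u : F) : Prop :=
  ∃ (C M : ℝ) (a : ℕ → T.domain), 0 ≤ C ∧ 0 ≤ M ∧ (a 0 : F) = u ∧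
    (∀ n, (a (n + 1) : F) = T (a n)) ∧ ∀ n, ‖(a n : F)‖ ≤ C * M ^ n * (n ! : ℝ)

/-- The cross term vanishes because `⟨Tx, x⟩` is real. Thus `T - i` controls the graph norm. -/
theorem norm_sq_apply_sub_I_smul (hT : T.IsFormalAdjoint T) (x : T.domain) :
    ‖T x - Complex.I • (x : F)‖ ^ 2 = ‖T x‖ ^ 2 + ‖(x : F)‖ ^ 2 := by
  have h1 : inner ℂ (T x) (x : F) = inner ℂ (x : F) (T x) := hT x x
  have h2 : (inner ℂ (T x) (Complex.I • (x : F))).re = 0 := by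
    have h3 : (inner ℂ (T x) (x : F)).im = 0 := by
      have h4 := congrArg Complex.im (inner_conj_symm (𝕜 := ℂ) (T x) (x : F))
      rw [← h1, Complex.conj_im] at h4
      linarith
    rw [inner_smul_right, Complex.mul_re, h3]
    simp
  have h5 := @norm_sub_sq ℂ F _ _ _ (T x) (Complex.I • (x : F))
  rw [h5, norm_smul, Complex.norm_I, one_mul]
  change _ - 2 * (inner ℂ (T x) (Complex.I • (x : F))).re + _ = _
  rw [h2]
  ring

/-- Symmetry is a closed condition on pairs of graph points. Stating it for the closure of the graph
makes it usable before closability is known. -/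
theorem mem_closure_graph_isFormalAdjoint (hT : T.IsFormalAdjoint T) {p q : F × F}
    (hp : p ∈ T.graph.topologicalClosure) (hq : q ∈ T.graph.topologicalClosure) :
    inner ℂ p.2 q.1 = inner ℂ p.1 q.2 := by
  have hc : IsClosed {r : (F × F) × (F × F) | inner ℂ r.1.2 r.2.1 = inner ℂ r.1.1 r.2.2} :=
    isClosed_eq (by fun_prop) (by fun_prop)
  have hmem : (p, q) ∈ closure ((T.graph : Set (F × F)) ×ˢ (T.graph : Set (F × F))) := by
    rw [closure_prod_eq]
    exact ⟨hp, hq⟩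
  refine closure_minimal ?_ hc hmem
  rintro ⟨⟨x, x'⟩, ⟨y, y'⟩⟩ ⟨hx, hy⟩
  obtain ⟨x, rfl, rfl⟩ := (LinearPMap.mem_graph_iff T).mp hx
  obtain ⟨y, rfl, rfl⟩ := (LinearPMap.mem_graph_iff T).mp hy
  exact hT x y

variable [CompleteSpace F]

/-- The deficiency spaces are trivial: such a `w` is orthogonal to every analytic vector in the
dense set. -/
theorem eq_zero_of_inner_apply_eq (hT : T.IsFormalAdjoint T) {S : Set F} (hS : Dense S)
    (ha : ∀ u ∈ S, IsAnalyticVector T u) {w : F} {z : ℂ} (hz : z.im ≠ 0)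
    (hw : ∀ x : T.domain, inner ℂ w (T x) = z * inner ℂ w (x : F)) : w = 0 := by
  refine hS.eq_zero_of_inner_left (𝕜 := ℂ) fun u hu => ?_
  obtain ⟨C, M, a, hC, hM, rfl, hstep, hb⟩ := ha u hu
  have h : IsAnalyticSeq C M fun n => (a n : F) :=
    ⟨fun m n => by rw [hstep, hstep]; exact hT _ _, hb⟩
  exact h.inner_eq_zero hC hM hz fun n => by rw [hstep]; exact hw _

/-- For a symmetric operator with a dense set of analytic vectors, the closure of the graph
contains the graph of the adjoint. -/
theorem mem_closure_graph_of_adjoint (hT : T.IsFormalAdjoint T) {S : Set F} (hS : Dense S)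
    (ha : ∀ u ∈ S, IsAnalyticVector T u) {v g : F}
    (hv : ∀ x : T.domain, inner ℂ v (T x) = inner ℂ g (x : F)) :
    (v, g) ∈ T.graph.topologicalClosure := by
  have hdense : Dense (Set.range fun x : T.domain => T x - Complex.I • (x : F)) := by
    have h1 : (Set.range fun x : T.domain => T x - Complex.I • (x : F)) =
        ((LinearMap.range (T.toFun - Complex.I • T.domain.subtype) : Submodule ℂ F) : Set F) := by
      ext y; simp
    rw [h1, Submodule.dense_iff_topologicalClosure_eq_top,
      Submodule.topologicalClosure_eq_top_iff, Submodule.eq_bot_iff]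
    intro w hw
    refine eq_zero_of_inner_apply_eq hT hS ha (z := Complex.I) (by simp) fun x => ?_
    have h2 : inner ℂ w (T x - Complex.I • (x : F)) = 0 :=
      Submodule.inner_left_of_mem_orthogonal (LinearMap.mem_range.mpr ⟨x, rfl⟩) hw
    rw [inner_sub_right, inner_smul_right] at h2
    linear_combination h2
  -- Solve `(T - i) x = g - iv` approximately. By the graph norm identity the points `(xₙ, T xₙ)`
  -- form a Cauchy sequence, and their limit `p` turns out to be `(v, g)`.
  obtain ⟨y, hy, hlim⟩ := mem_closure_iff_seq_limit.mp (hdense (g - Complex.I • v))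
  choose x hx using hy
  have hcau : CauchySeq y := hlim.cauchySeq
  have hle : ∀ m n, ‖((x m : F), T (x m)) - ((x n : F), T (x n))‖ ≤ ‖y m - y n‖ := by
    intro m n
    have h1 := norm_sq_apply_sub_I_smul hT (x m - x n)
    have h2 : T (x m - x n) - Complex.I • ((x m - x n : T.domain) : F) = y m - y n := by
      rw [← hx m, ← hx n, T.map_sub, Submodule.coe_sub, smul_sub]
      dsimp only
      rw [sub_sub_sub_comm]
    rw [h2] at h1
    rw [Prod.mk_sub_mk, ← T.map_sub, ← Submodule.coe_sub, Prod.norm_mk]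
    refine max_le ?_ ?_ <;> refine abs_le_of_sq_le_sq' ?_ (norm_nonneg _) |>.2 <;>
      rw [h1] <;> nlinarith [sq_nonneg ‖T (x m - x n)‖, sq_nonneg ‖((x m - x n : T.domain) : F)‖]
  have hcau' : CauchySeq fun n => ((x n : F), T (x n)) := by
    rw [Metric.cauchySeq_iff] at hcau ⊢
    intro ε hε
    obtain ⟨N, hN⟩ := hcau ε hε
    refine ⟨N, fun m hm n hn => ?_⟩
    have := hN m hm n hn
    rw [dist_eq_norm] at this ⊢
    exact (hle m n).trans_lt this
  obtain ⟨p, hp⟩ := cauchySeq_tendsto_of_complete hcau'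
  have hpm : p ∈ T.graph.topologicalClosure := by
    rw [← SetLike.mem_coe, Submodule.topologicalClosure_coe]
    exact mem_closure_of_tendsto hp (Eventually.of_forall fun n => T.mem_graph (x n))
  have hpeq : p.2 - Complex.I • p.1 = g - Complex.I • v := by
    refine tendsto_nhds_unique ?_ hlim
    have h3 := hp.snd_nhds.sub (hp.fst_nhds.const_smul Complex.I)
    simpa only [hx] using h3
  -- The adjoint sends `v - p.1` to `g - p.2 = i (v - p.1)`. Antilinearity in the first argument
  -- turns the eigenvalue into `-i`, so the triviality of the other deficiency space applies.
  have hzero : v - p.1 = 0 := by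
    refine eq_zero_of_inner_apply_eq hT hS ha (z := -Complex.I) (by simp) fun x => ?_
    have h4 : inner ℂ p.1 (T x) = inner ℂ p.2 (x : F) :=
      (mem_closure_graph_isFormalAdjoint hT hpm
        (Submodule.le_topologicalClosure _ (T.mem_graph x))).symm
    have h5 : g = p.2 + Complex.I • (v - p.1) := by
      rw [smul_sub, ← sub_eq_zero]
      rw [← sub_eq_zero] at hpeq
      rw [← neg_eq_zero, ← hpeq]
      abel
    rw [inner_sub_left, hv, h4, h5, inner_add_left, inner_smul_left, Complex.conj_I]
    ring
  rw [sub_eq_zero] at hzero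
  have hg : p.2 = g := by
    rw [hzero] at hpeq
    exact sub_left_injective hpeq
  rw [hzero, ← hg]
  exact hpm

/-- Nelson's analytic vector theorem. -/
theorem isEssentiallySelfAdjoint_of_analyticVectors (hT : T.IsFormalAdjoint T)
    (hd : Dense (T.domain : Set F)) {S : Set F} (hS : Dense S)
    (ha : ∀ u ∈ S, IsAnalyticVector T u) : IsEssentiallySelfAdjoint T := by
  refine ⟨hd, hT, ?_⟩
  have hcl : T.IsClosable :=
    (T.adjoint_isClosed hd).isClosable.leIsClosable (hT.le_adjoint hd)
  have hgr := hcl.graph_closure_eq_closure_graph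
  have hd' : Dense (T.closure.domain : Set F) := hd.mono T.le_closure.1
  have hsym : T.closure.IsFormalAdjoint T.closure := by
    intro x y
    have hx := T.closure.mem_graph x
    have hy := T.closure.mem_graph y
    rw [← hgr] at hx hy
    exact mem_closure_graph_isFormalAdjoint hT hx hy
  rw [LinearPMap.isSelfAdjoint_def]
  refine le_antisymm ?_ (hsym.le_adjoint hd')
  refine LinearPMap.le_of_le_graph ?_
  rintro ⟨v, g⟩ hvg
  obtain ⟨v, rfl, rfl⟩ := (LinearPMap.mem_graph_iff _).mp hvg
  rw [← hgr]
  refine mem_closure_graph_of_adjoint hT hS ha fun x => ?_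
  have h1 := T.closure.adjoint_isFormalAdjoint hd' v ⟨x, T.le_closure.1 x.2⟩
  rw [T.le_closure.2 (y := ⟨x, T.le_closure.1 x.2⟩) rfl]
  exact h1.symm

end AnalyticVectors

end Nelson

/-! ### `L²` bounds for the annihilation kernel -/

section Kernels

variable {d : ℕ}

theorem eLpNorm_two_sq {α : Type*} [MeasurableSpace α] {μ : Measure α} (f : α → ℂ) :
    eLpNorm f 2 μ ^ 2 = ∫⁻ x, ‖f x‖ₑ ^ 2 ∂μ := by
  have h := eLpNorm_nnreal_pow_eq_lintegral (f := f) (μ := μ) (p := 2) (by norm_num)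
  simpa using h

theorem eLpNorm_two_le_of_lintegral {α β : Type*} [MeasurableSpace α] [MeasurableSpace β]
    {μ : Measure α} {ν : Measure β} {f : α → ℂ} {g : β → ℂ} {C : ℝ≥0∞}
    (h : ∫⁻ x, ‖f x‖ₑ ^ 2 ∂μ ≤ C ^ 2 * ∫⁻ y, ‖g y‖ₑ ^ 2 ∂ν) :
    eLpNorm f 2 μ ≤ C * eLpNorm g 2 ν := by
  rw [← eLpNorm_two_sq, ← eLpNorm_two_sq, ← mul_pow] at h
  exact (ENNReal.pow_le_pow_left_iff two_ne_zero).mp h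

/-- The inverse Fourier integral and the inverse `L²` Fourier transform agree. -/
theorem fourierInv_ae_eq {g : Space d → ℂ} (h1 : Integrable g) (h2 : MemLp g 2) :
    𝓕⁻ g =ᵐ[volume] (𝓕⁻ (h2.toLp g) : Lp ℂ 2 (volume : Measure (Space d))) := by
  have hL : Continuous fun p : Space d × Space d => (-innerₗ (Space d)) p.1 p.2 := by
    simp only [LinearMap.neg_apply, innerₗ_apply_apply]
    fun_prop
  have hcont : Continuous (𝓕⁻ g) :=
    VectorFourier.fourierIntegral_continuous Real.continuous_fourierChar hL h1
  refine ae_eq_of_integral_contDiff_smul_eq hcont.locallyIntegrable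
    ((Lp.memLp _).locallyIntegrable one_le_two) fun φ hφ hφs => ?_
  have hg₁ : HasCompactSupport (Complex.ofRealCLM ∘ φ) := hφs.comp_left rfl
  have hg₂ : ContDiff ℝ (⊤ : ℕ∞) (Complex.ofRealCLM ∘ φ) := by fun_prop
  set Φ : 𝓢(Space d, ℂ) := hg₁.toSchwartzMap hg₂ with hΦ
  have hΦx : ∀ x, Φ x = (φ x : ℂ) := fun x => rfl
  have h3 : ∀ v : Space d → ℂ, ∫ x, φ x • v x = ∫ x, Φ x • v x := fun v => by
    simp only [hΦx, Complex.real_smul, smul_eq_mul]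
  -- The `L²` transform agrees with the distributional one, which is defined by moving the transform
  -- to the test function. For the integral transform, `h5` gives the same identity by Fubini, so
  -- both functions have the same pairings.
  have h4 := congrArg (fun T : 𝓢'(Space d, ℂ) => T Φ)
    (Lp.fourierInv_toTemperedDistribution_eq (h2.toLp g))
  simp only [TemperedDistribution.fourierInv_apply, Lp.toTemperedDistribution_apply] at h4
  rw [h3, h3, ← h4]
  have h5 := VectorFourier.integral_fourierIntegral_smul_eq_flip (μ := volume) (ν := volume)
    (L := -innerₗ (Space d)) (f := Φ) (g := g) Real.continuous_fourierChar hL Φ.integrable h1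
  have h6 : (-innerₗ (Space d)).flip = -innerₗ (Space d) := by
    ext x y; simp [real_inner_comm]
  rw [h6] at h5
  refine h5.symm.trans (integral_congr_ae ?_)
  filter_upwards [h2.coeFn_toLp] with x hx
  rw [hx, SchwartzMap.fourierInv_coe]
  rfl

theorem eLpNorm_fourierInv {g : Space d → ℂ} (h1 : Integrable g) (h2 : MemLp g 2) :
    eLpNorm (𝓕⁻ g) 2 volume = eLpNorm g 2 volume := by
  rw [eLpNorm_congr_ae (fourierInv_ae_eq h1 h2), ← eLpNorm_congr_ae h2.coeFn_toLp]
  have h : ‖(𝓕⁻ (h2.toLp g) : Lp ℂ 2 (volume : Measure (Space d)))‖ = ‖h2.toLp g‖ :=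
    (Lp.fourierTransformₗᵢ (Space d) ℂ).symm.norm_map _
  rw [Lp.norm_def, Lp.norm_def] at h
  exact (ENNReal.toReal_eq_toReal_iff' (Lp.eLpNorm_ne_top _) (Lp.eLpNorm_ne_top _)).mp h

/-- The function multiplication by which is `(1 - K)^{1/2}` in momentum space. -/
def complementSymbol (khat : Space d → ℝ) (ξ : Space d) : ℂ :=
  ((√(1 - khat ((2 * Real.pi) • ξ)) : ℝ) : ℂ)

theorem aestronglyMeasurable_complementSymbol {khat : Space d → ℝ} (hk : Integrable khat volume) :
    AEStronglyMeasurable (complementSymbol khat) volume := by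
  have hk' : Integrable (fun ξ => khat ((2 * Real.pi) • ξ)) volume :=
    hk.comp_smul (by positivity)
  exact (Complex.continuous_ofReal.comp Real.continuous_sqrt).comp_aestronglyMeasurable
    (aestronglyMeasurable_const.sub hk'.aestronglyMeasurable)

theorem norm_complementSymbol_le {khat : Space d → ℝ}
    (hk_nonneg : ∀ᵐ p ∂(volume : Measure (Space d)), 0 ≤ khat p) :
    ∀ᵐ ξ ∂(volume : Measure (Space d)), ‖complementSymbol khat ξ‖ ≤ 1 := by
  have h := (Measure.quasiMeasurePreserving_smul (volume : Measure (Space d))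
    (r := 2 * Real.pi) (by positivity)).ae hk_nonneg
  filter_upwards [h] with ξ hξ
  rw [complementSymbol, Complex.norm_real, Real.norm_eq_abs, abs_of_nonneg (Real.sqrt_nonneg _),
    Real.sqrt_le_one]
  linarith

theorem integrable_symbol_mul {khat : Space d → ℝ} (hk : Integrable khat volume)
    (hk_nonneg : ∀ᵐ p ∂(volume : Measure (Space d)), 0 ≤ khat p) (h : 𝓢(Space d, ℂ)) :
    Integrable fun ξ => complementSymbol khat ξ * 𝓕 (h : Space d → ℂ) ξ :=
  (𝓕 h).integrable.bdd_mul (aestronglyMeasurable_complementSymbol hk)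
    (norm_complementSymbol_le hk_nonneg)

theorem eLpNorm_fourier_schwartz (h : 𝓢(Space d, ℂ)) :
    eLpNorm (𝓕 h : 𝓢(Space d, ℂ)) 2 volume = eLpNorm h 2 volume := by
  have h3 := SchwartzMap.norm_fourier_toL2_eq h
  rw [SchwartzMap.norm_toLp, SchwartzMap.norm_toLp] at h3
  have h1 : eLpNorm (𝓕 h : 𝓢(Space d, ℂ)) 2 volume ≠ ∞ :=
    ((𝓕 h : 𝓢(Space d, ℂ)).memLp 2 volume).eLpNorm_ne_top
  have h2 : eLpNorm h 2 volume ≠ ∞ := (h.memLp 2 volume).eLpNorm_ne_top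
  rw [← ENNReal.ofReal_toReal h1, ← ENNReal.ofReal_toReal h2]
  exact congrArg ENNReal.ofReal h3

/-- Plancherel with a symbol of modulus at most one: `(1 - K)^{1/2}` is a contraction. On Schwartz
functions the symbol times the transform is both integrable and square integrable, so the pointwise
inverse integral represents the `L²` image. -/
theorem eLpNorm_pairKappaTwo_le {khat : Space d → ℝ} (hk : Integrable khat volume)
    (hk_nonneg : ∀ᵐ p ∂(volume : Measure (Space d)), 0 ≤ khat p) (h : 𝓢(Space d, ℂ)) :
    eLpNorm (fun x => pairKappaTwo khat x h) 2 volume ≤ eLpNorm h 2 volume := by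
  have hle : ∀ᵐ ξ ∂(volume : Measure (Space d)),
      ‖complementSymbol khat ξ * 𝓕 (h : Space d → ℂ) ξ‖ ≤ ‖(𝓕 h : 𝓢(Space d, ℂ)) ξ‖ := by
    filter_upwards [norm_complementSymbol_le hk_nonneg] with ξ hξ
    rw [norm_mul]
    exact mul_le_of_le_one_left (norm_nonneg _) hξ
  have h1 := integrable_symbol_mul hk hk_nonneg h
  have h2 : MemLp (fun ξ => complementSymbol khat ξ * 𝓕 (h : Space d → ℂ) ξ) 2 :=
    ((𝓕 h : 𝓢(Space d, ℂ)).memLp 2).of_le h1.aestronglyMeasurable hle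
  have h4 : (fun x => pairKappaTwo khat x h) =
      𝓕⁻ (fun ξ => complementSymbol khat ξ * 𝓕 (h : Space d → ℂ) ξ) := rfl
  rw [h4, eLpNorm_fourierInv h1 h2]
  refine (eLpNorm_mono_ae hle).trans_eq ?_
  exact eLpNorm_fourier_schwartz h

theorem pairKappaTwo_add {khat : Space d → ℝ} (hk : Integrable khat volume)
    (hk_nonneg : ∀ᵐ p ∂(volume : Measure (Space d)), 0 ≤ khat p) (x : Space d)
    (g h : 𝓢(Space d, ℂ)) :
    pairKappaTwo khat x (g + h : 𝓢(Space d, ℂ)) =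
      pairKappaTwo khat x g + pairKappaTwo khat x h := by
  have h1 : (fun ξ => complementSymbol khat ξ * 𝓕 ((g + h : 𝓢(Space d, ℂ)) : Space d → ℂ) ξ) =
      (fun ξ => complementSymbol khat ξ * 𝓕 (g : Space d → ℂ) ξ) +
        fun ξ => complementSymbol khat ξ * 𝓕 (h : Space d → ℂ) ξ := by
    funext ξ
    rw [← SchwartzMap.fourier_coe, FourierTransform.fourier_add, Pi.add_apply,
      add_apply, mul_add]
    rfl
  have hL : Continuous fun p : Space d × Space d => (-innerₗ (Space d)) p.1 p.2 := by
    simp only [LinearMap.neg_apply, innerₗ_apply_apply]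
    fun_prop
  have h2 := VectorFourier.fourierIntegral_add (μ := volume) (L := -innerₗ (Space d))
    Real.continuous_fourierChar hL (integrable_symbol_mul hk hk_nonneg g)
    (integrable_symbol_mul hk hk_nonneg h)
  rw [← h1] at h2
  exact congrFun h2 x

theorem pairKappaTwo_smul (khat : Space d → ℝ) (x : Space d) (c : ℂ) (h : 𝓢(Space d, ℂ)) :
    pairKappaTwo khat x (c • h : 𝓢(Space d, ℂ)) = c * pairKappaTwo khat x h := by
  have h1 : (fun ξ => complementSymbol khat ξ * 𝓕 ((c • h : 𝓢(Space d, ℂ)) : Space d → ℂ) ξ) =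
      c • fun ξ => complementSymbol khat ξ * 𝓕 (h : Space d → ℂ) ξ := by
    funext ξ
    rw [← SchwartzMap.fourier_coe, FourierTransform.fourier_smul, Pi.smul_apply,
      smul_apply, mul_smul_comm]
    rfl
  have h2 := VectorFourier.fourierIntegral_const_smul Real.fourierChar volume
    (-innerₗ (Space d)) (fun ξ => complementSymbol khat ξ * 𝓕 (h : Space d → ℂ) ξ) c
  rw [← h1] at h2
  exact congrFun h2 x

/-- The restriction of a Schwartz function of `n + 1` particles to a fixed position of all
particles but the first one. -/
def slice {n : ℕ} (y : Fin n → Space d) : 𝓢(Fin (n + 1) → Space d, ℂ) →L[ℂ] 𝓢(Space d, ℂ) :=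
  SchwartzMap.compCLMOfAntilipschitz ℂ (K := 1)
    (g := fun z => (Fin.cons z y : Fin (n + 1) → Space d))
    (by
      have h : (fun z : Space d => (Fin.cons z y : Fin (n + 1) → Space d)) =
          (fun _ : Space d => (Fin.cons 0 y : Fin (n + 1) → Space d)) +
            ⇑(ContinuousLinearMap.single ℝ (fun _ : Fin (n + 1) => Space d) 0) := by
        funext z
        ext1 i
        refine Fin.cases ?_ (fun j => ?_) i <;> simp
      rw [h]
      exact (Function.HasTemperateGrowth.const _).add
        (ContinuousLinearMap.hasTemperateGrowth _))
    (by
      refine AntilipschitzWith.of_le_mul_dist fun z z' => ?_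
      rw [NNReal.coe_one, one_mul]
      exact dist_le_pi_dist (Fin.cons z y : Fin (n + 1) → Space d) (Fin.cons z' y) 0)

theorem slice_coe {n : ℕ} (y : Fin n → Space d) (h : 𝓢(Fin (n + 1) → Space d, ℂ)) :
    (slice y h : Space d → ℂ) = fun z => h (Fin.cons z y : Fin (n + 1) → Space d) := rfl

theorem continuous_cons {n : ℕ} :
    Continuous fun p : Space d × (Fin n → Space d) =>
      (Fin.cons p.1 p.2 : Fin (n + 1) → Space d) := by
  refine continuous_pi fun i => ?_
  refine Fin.cases ?_ (fun j => ?_) i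
  · simpa using continuous_fst
  · exact (continuous_apply j).comp continuous_snd

/-- Joint measurability in the position and the remaining particles is needed for Tonelli and
Fubini. It comes from writing the pairing as an iterated parameter integral, with the symbol
replaced by a strongly measurable representative, which leaves every integral unchanged. -/
theorem aestronglyMeasurable_pairKappaTwo {khat : Space d → ℝ} (hk : Integrable khat volume)
    {n : ℕ} (h : 𝓢(Fin (n + 1) → Space d, ℂ)) :
    StronglyMeasurable (fun p : Space d × (Fin n → Space d) =>
      pairKappaTwo khat p.1 (slice p.2 h)) := by
  obtain ⟨m, hm, hme⟩ := aestronglyMeasurable_complementSymbol hk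
  have h1 : ∀ p : Space d × (Fin n → Space d), pairKappaTwo khat p.1 (slice p.2 h) =
      ∫ ξ, Real.fourierChar (inner ℝ ξ p.1) • (m ξ *
        ∫ z, Real.fourierChar (-inner ℝ z ξ) • h (Fin.cons z p.2 : Fin (n + 1) → Space d)) := by
    intro p
    rw [pairKappaTwo, Real.fourierInv_eq]
    refine integral_congr_ae ?_
    filter_upwards [hme] with ξ hξ
    rw [← hξ, Real.fourier_eq]
    rfl
  simp_rw [h1]
  have h2 : StronglyMeasurable fun q : (Space d × (Fin n → Space d)) × Space d =>
      ∫ z, Real.fourierChar (-inner ℝ z q.2) •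
        h (Fin.cons z q.1.2 : Fin (n + 1) → Space d) := by
    refine StronglyMeasurable.integral_prod_right' (f := fun r :
      ((Space d × (Fin n → Space d)) × Space d) × Space d =>
        Real.fourierChar (-inner ℝ r.2 r.1.2) •
          h (Fin.cons r.2 r.1.1.2 : Fin (n + 1) → Space d)) (Continuous.stronglyMeasurable ?_)
    refine Continuous.smul ?_ ?_
    · exact (continuous_subtype_val.comp Real.continuous_fourierChar).comp
        (continuous_snd.inner (continuous_snd.comp continuous_fst)).neg
    · exact h.continuous.comp (continuous_cons.comp
        (continuous_snd.prodMk (continuous_snd.comp (continuous_fst.comp continuous_fst))))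
  refine StronglyMeasurable.integral_prod_right' (f := fun q :
      (Space d × (Fin n → Space d)) × Space d => Real.fourierChar (inner ℝ q.2 q.1.1) • (m q.2 *
        ∫ z, Real.fourierChar (-inner ℝ z q.2) •
          h (Fin.cons z q.1.2 : Fin (n + 1) → Space d))) ?_
  refine StronglyMeasurable.smul ?_ ((hm.comp_measurable measurable_snd).mul h2)
  exact ((continuous_subtype_val.comp Real.continuous_fourierChar).comp
    (continuous_snd.inner (continuous_fst.comp continuous_fst))).stronglyMeasurable

theorem lintegral_succAbove {n : ℕ} (i : Fin (n + 1)) {F : (Fin (n + 1) → Space d) → ℝ≥0∞}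
    (hF : Measurable F) :
    ∫⁻ y, F y = ∫⁻ y' : Fin n → Space d, ∫⁻ z : Space d, F (i.insertNth z y') := by
  have h := (volume_preserving_piFinSuccAbove (fun _ : Fin (n + 1) => Space d) i).symm
  rw [← h.lintegral_comp hF, Measure.volume_eq_prod, lintegral_prod_symm']
  · rfl
  · exact hF.comp (MeasurableEquiv.measurable _)

/-- The integral kernel of the annihilation operator, smeared with a weight. -/
def annihilateKernel (khat : Space d → ℝ) (w : Space d → ℝ) {n : ℕ}
    (h : 𝓢(Fin (n + 1) → Space d, ℂ)) (p : Space d × (Fin n → Space d)) : ℂ :=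
  w p.1 * pairKappaTwo khat p.1 (slice p.2 h)

/-- With the other particles frozen at `y`, the contraction bound applies to each slice; Tonelli
then integrates over `y`. -/
theorem eLpNorm_annihilateKernel_le {khat : Space d → ℝ} (hk : Integrable khat volume)
    (hk_nonneg : ∀ᵐ p ∂(volume : Measure (Space d)), 0 ≤ khat p) {w : Space d → ℝ} {C : ℝ}
    (hwm : Measurable w) (hwC : ∀ x, |w x| ≤ C) {n : ℕ} (h : 𝓢(Fin (n + 1) → Space d, ℂ)) :
    eLpNorm (annihilateKernel khat w h) 2 volume ≤ ENNReal.ofReal C * eLpNorm h 2 volume := by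
  refine eLpNorm_two_le_of_lintegral ?_
  have hm := aestronglyMeasurable_pairKappaTwo hk h
  have hm2 : Measurable fun p : Space d × (Fin n → Space d) =>
      ‖annihilateKernel khat w h p‖ₑ ^ 2 :=
    (((Complex.measurable_ofReal.comp (hwm.comp measurable_fst)).mul
      hm.measurable).enorm).pow_const 2
  have hh : Measurable fun y => ‖h y‖ₑ ^ 2 := h.continuous.measurable.enorm.pow_const 2
  rw [Measure.volume_eq_prod, lintegral_prod_symm' _ hm2, lintegral_succAbove 0 hh,
    ← lintegral_const_mul' _ _ (by finiteness)]
  refine lintegral_mono fun y => ?_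
  calc ∫⁻ x, ‖annihilateKernel khat w h (x, y)‖ₑ ^ 2
      ≤ ∫⁻ x, ENNReal.ofReal C ^ 2 * ‖pairKappaTwo khat x (slice y h)‖ₑ ^ 2 := by
        refine lintegral_mono fun x => ?_
        dsimp only
        rw [annihilateKernel, enorm_mul, mul_pow]
        gcongr
        rw [← ofReal_norm, Complex.norm_real]
        exact ENNReal.ofReal_le_ofReal (hwC x)
    _ = ENNReal.ofReal C ^ 2 * eLpNorm (fun x => pairKappaTwo khat x (slice y h)) 2 volume ^ 2 := by
        rw [lintegral_const_mul' _ _ (by finiteness), eLpNorm_two_sq]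
    _ ≤ ENNReal.ofReal C ^ 2 * eLpNorm (slice y h) 2 volume ^ 2 := by
        gcongr
        exact eLpNorm_pairKappaTwo_le hk hk_nonneg _
    _ = _ := by
        rw [eLpNorm_two_sq]
        simp only [slice_coe, Fin.insertNth_zero']

end Kernels

/-! ### Extension of the annihilation and creation kernels from Schwartz functions to `L²` -/

section Extensions

variable {d : ℕ}

/-- An operator on Schwartz functions which is bounded in `L²` extends to `L²`. -/
theorem exists_extension {m : ℕ} {Z : Type*} [MeasurableSpace Z] {μ : Measure Z}
    (K : 𝓢(Fin m → Space d, ℂ) → Z → ℂ) (hadd : ∀ f g, K (f + g) = K f + K g)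
    (hsmul : ∀ (c : ℂ) f, K (c • f) = c • K f) (hm : ∀ f, AEStronglyMeasurable (K f) μ)
    {C : ℝ≥0∞} (hC : C ≠ ∞) (hb : ∀ f, eLpNorm (K f) 2 μ ≤ C * eLpNorm f 2 volume) :
    ∃ L : Lp ℂ 2 (volume : Measure (Fin m → Space d)) →L[ℂ] Lp ℂ 2 μ,
      (∀ u, ‖L u‖ ≤ C.toReal * ‖u‖) ∧ ∀ f : 𝓢(Fin m → Space d, ℂ), L (f.toLp 2) =ᵐ[μ] K f := by
  have hmem : ∀ f, MemLp (K f) 2 μ := fun f =>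
    ⟨hm f, (hb f).trans_lt (ENNReal.mul_lt_top hC.lt_top (f.memLp 2 volume).2)⟩
  let T : 𝓢(Fin m → Space d, ℂ) →ₗ[ℂ] Lp ℂ 2 μ :=
    { toFun := fun f => (hmem f).toLp (K f)
      map_add' := fun f g => by
        rw [← MemLp.toLp_add]
        exact MemLp.toLp_congr _ _ (by rw [hadd])
      map_smul' := fun c f => by
        rw [RingHom.id_apply, ← MemLp.toLp_const_smul]
        exact MemLp.toLp_congr _ _ (by rw [hsmul]) }
  let e : 𝓢(Fin m → Space d, ℂ) →ₗ[ℂ] Lp ℂ 2 (volume : Measure (Fin m → Space d)) :=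
    (SchwartzMap.toLpCLM ℂ ℂ 2 volume).toLinearMap
  have hdense : DenseRange e := SchwartzMap.denseRange_toLpCLM ENNReal.ofNat_ne_top
  have hnorm : ∀ f, ‖T f‖ ≤ C.toReal * ‖e f‖ := by
    intro f
    have h1 : ‖T f‖ = (eLpNorm (K f) 2 μ).toReal := Lp.norm_toLp _ (hmem f)
    have h2 : ‖e f‖ = (eLpNorm f 2 volume).toReal := SchwartzMap.norm_toLp
    rw [h1, h2, ← ENNReal.toReal_mul]
    exact ENNReal.toReal_mono (ENNReal.mul_ne_top hC (f.memLp 2 volume).2.ne) (hb f)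
  refine ⟨T.extendOfNorm e, LinearMap.norm_extendOfNorm_apply_le hdense _ hnorm, fun f => ?_⟩
  have h3 : T.extendOfNorm e (f.toLp 2) = T f :=
    LinearMap.extendOfNorm_eq hdense ⟨_, hnorm⟩ f
  rw [h3]
  exact (hmem f).coeFn_toLp

theorem exists_annihilate_extension {khat : Space d → ℝ} (hk : Integrable khat volume)
    (hk_nonneg : ∀ᵐ p ∂(volume : Measure (Space d)), 0 ≤ khat p) {w : Space d → ℝ} {C : ℝ}
    (hwm : Measurable w) (hwC : ∀ x, |w x| ≤ C) (n : ℕ) :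
    ∃ L : Lp ℂ 2 (volume : Measure (Fin (n + 1) → Space d)) →L[ℂ]
        Lp ℂ 2 (volume : Measure (Space d × (Fin n → Space d))),
      (∀ u, ‖L u‖ ≤ C * ‖u‖) ∧
        ∀ f : 𝓢(Fin (n + 1) → Space d, ℂ), L (f.toLp 2) =ᵐ[volume] annihilateKernel khat w f := by
  have hC : 0 ≤ C := (abs_nonneg _).trans (hwC 0)
  have h := exists_extension (annihilateKernel khat w (n := n))
    (fun f g => by
      funext p
      simp only [annihilateKernel, Pi.add_apply, map_add, pairKappaTwo_add hk hk_nonneg, mul_add])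
    (fun c f => by
      funext p
      simp only [annihilateKernel, Pi.smul_apply, map_smul, pairKappaTwo_smul, smul_eq_mul]
      ring)
    (fun f => (((Complex.measurable_ofReal.comp (hwm.comp measurable_fst)).mul
      (aestronglyMeasurable_pairKappaTwo hk f).measurable).aestronglyMeasurable :
        AEStronglyMeasurable _ (volume : Measure (Space d × (Fin n → Space d)))))
    ENNReal.ofReal_ne_top (eLpNorm_annihilateKernel_le hk hk_nonneg hwm hwC)
  rwa [ENNReal.toReal_ofReal hC] at h

/-- The integral kernel of the creation operator in the `i`-th particle, smeared with a weight. -/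
def createKernel (κ : Lp ℂ 2 (volume : Measure (Space d))) (w : Space d → ℝ) {n : ℕ}
    (i : Fin (n + 1)) (h : 𝓢(Fin n → Space d, ℂ)) (p : Space d × (Fin (n + 1) → Space d)) : ℂ :=
  w p.1 * (conj (κ (p.2 i - p.1)) * h (p.2 ∘ i.succAbove))

theorem measurable_createKernel (κ : Lp ℂ 2 (volume : Measure (Space d))) {w : Space d → ℝ}
    (hwm : Measurable w) {n : ℕ} (i : Fin (n + 1)) (h : 𝓢(Fin n → Space d, ℂ)) :
    Measurable (createKernel κ w i h) := by
  have hκ : Measurable κ := (Lp.stronglyMeasurable κ).measurable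
  have hi : Measurable fun p : Space d × (Fin (n + 1) → Space d) => p.2 i - p.1 :=
    ((measurable_pi_apply i).comp measurable_snd).sub measurable_fst
  have hs : Measurable fun p : Space d × (Fin (n + 1) → Space d) => p.2 ∘ i.succAbove :=
    measurable_pi_lambda _ fun j => (measurable_pi_apply _).comp measurable_snd
  exact (Complex.measurable_ofReal.comp (hwm.comp measurable_fst)).mul
    ((Complex.continuous_conj.measurable.comp (hκ.comp hi)).mul
      (h.continuous.measurable.comp hs))

/-- For fixed `x` the integral over the created particle is `‖κ‖²` by translation invariance,
whatever `x` is. The remaining integral of `w(x)²` is the reason for requiring `w ∈ L²`: boundedness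
of `w` would not suffice here. -/
theorem eLpNorm_createKernel_le (κ : Lp ℂ 2 (volume : Measure (Space d))) {w : Space d → ℝ}
    (hwm : Measurable w) {n : ℕ} (i : Fin (n + 1)) (h : 𝓢(Fin n → Space d, ℂ)) :
    eLpNorm (createKernel κ w i h) 2 volume ≤
      eLpNorm (fun x => (w x : ℂ)) 2 volume * eLpNorm κ 2 volume * eLpNorm h 2 volume := by
  refine eLpNorm_two_le_of_lintegral ?_
  have hκ : Measurable κ := (Lp.stronglyMeasurable κ).measurable
  have hm := measurable_createKernel κ hwm i h
  have hh : Measurable fun y => ‖h y‖ₑ ^ 2 := h.continuous.measurable.enorm.pow_const 2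
  rw [Measure.volume_eq_prod, lintegral_prod _ (hm.enorm.pow_const 2).aemeasurable]
  have h1 : ∀ x : Space d, ∫⁻ y, ‖createKernel κ w i h (x, y)‖ₑ ^ 2 =
      ‖(w x : ℂ)‖ₑ ^ 2 * (eLpNorm κ 2 volume ^ 2 * ∫⁻ y, ‖h y‖ₑ ^ 2) := by
    intro x
    have hmx : Measurable fun y => ‖createKernel κ w i h (x, y)‖ₑ ^ 2 :=
      (hm.comp measurable_prodMk_left).enorm.pow_const 2
    rw [lintegral_succAbove i hmx]
    have h2 : ∀ (y : Fin n → Space d) (z : Space d),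
        ‖createKernel κ w i h (x, i.insertNth z y)‖ₑ ^ 2 =
          ‖(w x : ℂ)‖ₑ ^ 2 * (‖κ (z - x)‖ₑ ^ 2 * ‖h y‖ₑ ^ 2) := by
      intro y z
      have h3 : (i.insertNth z y : Fin (n + 1) → Space d) ∘ i.succAbove = y := by
        funext j; simp
      simp only [createKernel, h3, Fin.insertNth_apply_same, enorm_mul, mul_pow]
      congr 2
      rw [← ofReal_norm, ← ofReal_norm, RCLike.norm_conj]
    simp_rw [h2]
    have h4 : ∀ y : Fin n → Space d,
        ∫⁻ z, ‖(w x : ℂ)‖ₑ ^ 2 * (‖κ (z - x)‖ₑ ^ 2 * ‖h y‖ₑ ^ 2) =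
          ‖(w x : ℂ)‖ₑ ^ 2 * (eLpNorm κ 2 volume ^ 2 * ‖h y‖ₑ ^ 2) := by
      intro y
      rw [lintegral_const_mul' _ _ (by finiteness), lintegral_mul_const' _ _ (by finiteness),
        lintegral_sub_right_eq_self (fun z => ‖κ z‖ₑ ^ 2) x, eLpNorm_two_sq]
    simp_rw [h4]
    rw [lintegral_const_mul' _ _ (by finiteness), lintegral_const_mul _ hh]
  simp_rw [h1]
  have hwm' : Measurable fun x => ‖(w x : ℂ)‖ₑ ^ 2 :=
    (Complex.measurable_ofReal.comp hwm).enorm.pow_const 2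
  rw [lintegral_mul_const _ hwm', ← eLpNorm_two_sq, mul_pow, mul_assoc]

theorem exists_create_extension (κ : Lp ℂ 2 (volume : Measure (Space d))) {w : Space d → ℝ}
    (hwm : Measurable w) (hw : MemLp (fun x => (w x : ℂ)) 2 volume) (n : ℕ) (i : Fin (n + 1)) :
    ∃ L : Lp ℂ 2 (volume : Measure (Fin n → Space d)) →L[ℂ]
        Lp ℂ 2 (volume : Measure (Space d × (Fin (n + 1) → Space d))),
      (∀ u, ‖L u‖ ≤ (eLpNorm (fun x => (w x : ℂ)) 2 volume * eLpNorm κ 2 volume).toReal * ‖u‖) ∧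
        ∀ f : 𝓢(Fin n → Space d, ℂ), L (f.toLp 2) =ᵐ[volume] createKernel κ w i f :=
  exists_extension (createKernel κ w i)
    (fun f g => by
      funext p
      simp only [createKernel, Pi.add_apply, add_apply]
      ring)
    (fun c f => by
      funext p
      simp only [createKernel, Pi.smul_apply, smul_apply, smul_eq_mul]
      ring)
    (fun f => (measurable_createKernel κ hwm i f).aestronglyMeasurable)
    (ENNReal.mul_ne_top hw.2.ne (Lp.eLpNorm_ne_top _))
    (eLpNorm_createKernel_le κ hwm i)

end Extensions

/-! ### Operators acting on families indexed by particle labels -/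

section Relabel

variable {E F ι κ : Type*} [NormedAddCommGroup E] [NormedSpace ℂ E] [NormedAddCommGroup F]
  [NormedSpace ℂ F]

/-- The operator `u ↦ (s ↦ L (u (σ s)))`, restricted to the labels `s` with `p s`. -/
def relabel (L : E →L[ℂ] F) (σ : ι → κ) (p : ι → Prop) [DecidablePred p] :
    PiLp 2 (fun _ : κ => E) →L[ℂ] PiLp 2 (fun _ : ι => F) :=
  (PiLp.continuousLinearEquiv 2 ℂ (fun _ : ι => F)).symm.toContinuousLinearMap ∘L
    ContinuousLinearMap.pi fun s => if p s then L ∘L PiLp.proj 2 (fun _ : κ => E) (σ s) else 0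

theorem relabel_apply (L : E →L[ℂ] F) (σ : ι → κ) (p : ι → Prop) [DecidablePred p]
    (u : PiLp 2 (fun _ : κ => E)) (s : ι) :
    relabel L σ p u s = if p s then L (u (σ s)) else 0 := by
  by_cases h : p s <;> simp [relabel, h]

theorem norm_relabel_le [Fintype ι] [Fintype κ] (L : E →L[ℂ] F) {σ : ι → κ} {p : ι → Prop}
    [DecidablePred p] (hσ : Set.InjOn σ {s | p s}) {c : ℝ} (hc : 0 ≤ c) (hL : ∀ v, ‖L v‖ ≤ c * ‖v‖)
    (u : PiLp 2 (fun _ : κ => E)) : ‖relabel L σ p u‖ ≤ c * ‖u‖ := by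
  refine abs_le_of_sq_le_sq' ?_ (by positivity) |>.2
  rw [mul_pow, PiLp.norm_sq_eq_of_L2, PiLp.norm_sq_eq_of_L2, Finset.mul_sum]
  calc ∑ s, ‖relabel L σ p u s‖ ^ 2
      = ∑ s ∈ Finset.univ.filter p, ‖L (u (σ s))‖ ^ 2 := by
        rw [Finset.sum_filter]
        refine Finset.sum_congr rfl fun s _ => ?_
        rw [relabel_apply]
        by_cases h : p s <;> simp [h]
    _ ≤ ∑ s ∈ Finset.univ.filter p, c ^ 2 * ‖u (σ s)‖ ^ 2 := by
        refine Finset.sum_le_sum fun s _ => ?_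
        rw [← mul_pow]
        gcongr
        exact hL _
    _ ≤ ∑ t, c ^ 2 * ‖u t‖ ^ 2 := by
        classical
        -- Injectivity of `σ` on the retained labels ensures that no component of `u` is counted
        -- twice.
        rw [← Finset.sum_image (s := Finset.univ.filter p) (g := σ)
          (f := fun t => c ^ 2 * ‖u t‖ ^ 2) (fun a ha b hb hab => hσ (by simpa using ha)
            (by simpa using hb) hab)]
        exact Finset.sum_le_sum_of_subset_of_nonneg (Finset.subset_univ _)
          fun _ _ _ => by positivity

end Relabel

/-! ### The form `∑ Φₙ* Φₙ` for operators coupling neighbouring particle numbers -/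

section Band

variable {G X : ℕ → Type*} [∀ n, NormedAddCommGroup (G n)]

theorem sum_norm_sq_le (u : lp G 2) (s : Finset ℕ) : ∑ n ∈ s, ‖u n‖ ^ 2 ≤ ‖u‖ ^ 2 := by
  have h := lp.sum_rpow_le_norm_rpow (p := 2) (by simp) u s
  simpa using h

/-- The squared norm of the component with one particle less. -/
def prevNormSq (u : lp G 2) : ℕ → ℝ
  | 0 => 0
  | n + 1 => ‖u n‖ ^ 2

theorem prevNormSq_nonneg (u : lp G 2) (n : ℕ) : 0 ≤ prevNormSq u n := by
  cases n with
  | zero => exact le_rfl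
  | succ n => exact sq_nonneg _

theorem sum_prevNormSq_le (u : lp G 2) (N : ℕ) :
    ∑ n ∈ Finset.range N, prevNormSq u n ≤ ‖u‖ ^ 2 := by
  cases N with
  | zero => simp
  | succ N =>
    rw [Finset.sum_range_succ']
    simpa [prevNormSq] using sum_norm_sq_le u (Finset.range N)

theorem sum_nextNormSq_le (u : lp G 2) (N : ℕ) :
    ∑ n ∈ Finset.range N, ‖u (n + 1)‖ ^ 2 ≤ ‖u‖ ^ 2 := by
  have h := sum_norm_sq_le u (Finset.range (N + 1))
  rw [Finset.sum_range_succ'] at h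
  nlinarith [sq_nonneg ‖u 0‖]

theorem norm_add_sq_le_two_mul {E : Type*} [SeminormedAddCommGroup E] (a b : E) :
    ‖a + b‖ ^ 2 ≤ 2 * (‖a‖ ^ 2 + ‖b‖ ^ 2) := by
  have h := pow_le_pow_left₀ (norm_nonneg _) (norm_add_le a b) 2
  nlinarith [sq_nonneg (‖a‖ - ‖b‖)]

theorem norm_add_sq_le_of_le {E : Type*} [SeminormedAddCommGroup E] {a b : E} {c x y : ℝ} {n : ℕ}
    (ha : ‖a‖ ≤ c * √(((n + 1 : ℕ) : ℝ) + 1) * x) (hb : ‖b‖ ≤ c * √((n : ℝ) + 1) * y) :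
    ‖a + b‖ ^ 2 ≤ 2 * c ^ 2 * (((n + 1 : ℕ) : ℝ) + 1) * (x ^ 2 + y ^ 2) := by
  have hs : ∀ m : ℕ, √((m : ℝ) + 1) ^ 2 = m + 1 := fun m => Real.sq_sqrt (by positivity)
  have ha' := pow_le_pow_left₀ (norm_nonneg _) ha 2
  have hb' := pow_le_pow_left₀ (norm_nonneg _) hb 2
  rw [mul_pow, mul_pow, hs] at ha' hb'
  have h1 : 0 ≤ c ^ 2 * y ^ 2 := by positivity
  push_cast at *
  linarith [norm_add_sq_le_two_mul a b]

theorem le_of_sq_le_sum_mul {ι : Type*} {s : Finset ι} {a b : ι → ℝ} {c x r : ℝ} (hc : 0 ≤ c)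
    (hx : 0 ≤ x) (hr : 0 ≤ r) (h : r ^ 2 ≤ ∑ i ∈ s, a i * b i)
    (ha : ∑ i ∈ s, a i ^ 2 ≤ c * x ^ 2) (hb : ∑ i ∈ s, b i ^ 2 ≤ c * r ^ 2) : r ≤ c * x := by
  have h7 : (r ^ 2) ^ 2 ≤ (c * x * r) ^ 2 := by
    calc (r ^ 2) ^ 2 ≤ (∑ i ∈ s, a i * b i) ^ 2 := by gcongr
      _ ≤ _ := Finset.sum_mul_sq_le_sq_mul_sq s a b
      _ ≤ (c * x ^ 2) * (c * r ^ 2) :=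
        mul_le_mul ha hb (Finset.sum_nonneg fun _ _ => sq_nonneg _) (by positivity)
      _ = _ := by ring
  have h8 : r ^ 2 ≤ c * x * r := abs_le_of_sq_le_sq' h7 (by positivity) |>.2
  rcases eq_or_lt_of_le hr with h9 | h9
  · rw [← h9]; positivity
  · rw [sq] at h8
    exact le_of_mul_le_mul_right h8 h9

/-- Testing the form with `v = r` and using Cauchy–Schwarz bounds `‖r‖²` by `c ‖u‖ ‖r‖`. The
constant is therefore that of the quadratic form, and the adjoints need no separate estimate. -/
theorem norm_le_of_inner_eq_sum {E : Type*} [NormedAddCommGroup E] [InnerProductSpace ℂ E]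
    {X : ℕ → Type*} [∀ n, NormedAddCommGroup (X n)] [∀ n, InnerProductSpace ℂ (X n)]
    (Φ : ∀ n, E →L[ℂ] X n) {s : Finset ℕ} {c : ℝ} (hc : 0 ≤ c) {r u : E}
    (h : ∀ v, inner ℂ r v = ∑ n ∈ s, inner ℂ (Φ n u) (Φ n v))
    (hb : ∀ v, ∑ n ∈ s, ‖Φ n v‖ ^ 2 ≤ c * ‖v‖ ^ 2) : ‖r‖ ≤ c * ‖u‖ := by
  have h1 : ‖r‖ ^ 2 ≤ ∑ n ∈ s, ‖Φ n u‖ * ‖Φ n r‖ := by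
    have h3 : ‖inner ℂ r r‖ = ‖r‖ ^ 2 := by
      rw [inner_self_eq_norm_sq_to_K]
      simp
    rw [← h3, h]
    exact norm_sum_le_of_le _ fun n _ => norm_inner_le_norm _ _
  exact le_of_sq_le_sum_mul hc (norm_nonneg _) (norm_nonneg _) h1 (hb u) (hb r)

variable [∀ n, InnerProductSpace ℂ (G n)]
  [∀ n, NormedAddCommGroup (X n)] [∀ n, InnerProductSpace ℂ (X n)]

/-- The `n`-th operator depends only on the components with `n + 1` and with `n - 1` particles, and
its norm grows like `√n`. -/
structure IsBand (C : ℝ) (Φ : ∀ n, lp G 2 →L[ℂ] X n) : Prop where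
  nonneg : 0 ≤ C
  eq_zero : ∀ n u, u (n + 1) = 0 → (∀ m, n = m + 1 → u m = 0) → Φ n u = 0
  norm_sq_le : ∀ n u, ‖Φ n u‖ ^ 2 ≤ C * (n + 1) * (‖u (n + 1)‖ ^ 2 + prevNormSq u n)

namespace IsBand

variable {C : ℝ} {Φ : ∀ n, lp G 2 →L[ℂ] X n}

/-- Each component of `u` enters at most twice, once from the particle number below and once from
the one above; hence the factor `2`. -/
theorem sum_norm_sq_le (hΦ : IsBand C Φ) (N : ℕ) (u : lp G 2) :
    ∑ n ∈ Finset.range N, ‖Φ n u‖ ^ 2 ≤ 2 * C * N * ‖u‖ ^ 2 := by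
  have hC := hΦ.nonneg
  have h1 : ∀ n ∈ Finset.range N, ‖Φ n u‖ ^ 2 ≤
      C * N * (‖u (n + 1)‖ ^ 2 + prevNormSq u n) := by
    intro n hn
    have hp := prevNormSq_nonneg u n
    refine (hΦ.norm_sq_le n u).trans ?_
    gcongr
    exact_mod_cast Finset.mem_range.mp hn
  refine (Finset.sum_le_sum h1).trans ?_
  rw [← Finset.mul_sum, Finset.sum_add_distrib]
  have h2 := sum_nextNormSq_le u N
  have h3 := sum_prevNormSq_le u N
  have h4 : 0 ≤ C * N := by positivity
  nlinarith

theorem eq_zero_of_vanish (hΦ : IsBand C Φ) {N n : ℕ} {u : lp G 2} (hu : ∀ m, N ≤ m → u m = 0)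
    (hn : N + 1 ≤ n) : Φ n u = 0 :=
  hΦ.eq_zero n u (hu _ (by omega)) fun m hm => hu _ (by omega)

variable [∀ n, CompleteSpace (G n)] [∀ n, CompleteSpace (X n)]

/-- The quadratic expression `∑ Φₙ* Φₙ`. -/
def square (Φ : ∀ n, lp G 2 →L[ℂ] X n) (u : lp G 2) : lp G 2 :=
  ∑' n, ContinuousLinearMap.adjoint (Φ n) (Φ n u)

theorem square_eq_sum (hΦ : IsBand C Φ) {N : ℕ} {u : lp G 2} (hu : ∀ m, N ≤ m → u m = 0) :
    square Φ u = ∑ n ∈ Finset.range (N + 1), ContinuousLinearMap.adjoint (Φ n) (Φ n u) := by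
  refine tsum_eq_sum fun n hn => ?_
  rw [hΦ.eq_zero_of_vanish hu (by simpa using hn), map_zero]

theorem inner_square (hΦ : IsBand C Φ) {N : ℕ} {u : lp G 2} (hu : ∀ m, N ≤ m → u m = 0)
    (v : lp G 2) :
    inner ℂ (square Φ u) v = ∑ n ∈ Finset.range (N + 1), inner ℂ (Φ n u) (Φ n v) := by
  rw [hΦ.square_eq_sum hu, sum_inner]
  exact Finset.sum_congr rfl fun n _ => ContinuousLinearMap.adjoint_inner_left _ _ _

/-- Only indices `n ≤ N` contribute for such `u`, and `Φₙ` ignores components beyond `n + 1`. The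
shift by two is the pair creation in `ψ* ψ`. -/
theorem square_apply_eq_zero (hΦ : IsBand C Φ) {N : ℕ} {u : lp G 2} (hu : ∀ m, N ≤ m → u m = 0)
    {m : ℕ} (hm : N + 2 ≤ m) : square Φ u m = 0 := by
  have h1 : inner ℂ (square Φ u) (lp.single 2 m (square Φ u m)) = 0 := by
    rw [hΦ.inner_square hu]
    refine Finset.sum_eq_zero fun n hn => ?_
    rw [Finset.mem_range] at hn
    have h2 : Φ n (lp.single 2 m (square Φ u m)) = 0 :=
      hΦ.eq_zero _ _ (lp.single_apply_ne 2 m _ (by omega))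
        fun k hk => lp.single_apply_ne 2 m _ (by omega)
    rw [h2, inner_zero_right]
  rw [lp.inner_single_right] at h1
  exact inner_self_eq_zero.mp h1

theorem square_add (hΦ : IsBand C Φ) {N M : ℕ} {u v : lp G 2} (hu : ∀ m, N ≤ m → u m = 0)
    (hv : ∀ m, M ≤ m → v m = 0) : square Φ (u + v) = square Φ u + square Φ v := by
  have hu' : ∀ m, max N M ≤ m → u m = 0 := fun m hm => hu m (le_of_max_le_left hm)
  have hv' : ∀ m, max N M ≤ m → v m = 0 := fun m hm => hv m (le_of_max_le_right hm)
  have huv : ∀ m, max N M ≤ m → (u + v) m = 0 := fun m hm => by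
    rw [lp.coeFn_add, Pi.add_apply, hu' m hm, hv' m hm, add_zero]
  rw [hΦ.square_eq_sum hu', hΦ.square_eq_sum hv', hΦ.square_eq_sum huv, ← Finset.sum_add_distrib]
  simp only [map_add]

theorem square_smul (hΦ : IsBand C Φ) {N : ℕ} {u : lp G 2} (hu : ∀ m, N ≤ m → u m = 0) (c : ℂ) :
    square Φ (c • u) = c • square Φ u := by
  have hcu : ∀ m, N ≤ m → (c • u) m = 0 := fun m hm => by
    rw [lp.coeFn_smul, Pi.smul_apply, hu m hm, smul_zero]
  rw [hΦ.square_eq_sum hu, hΦ.square_eq_sum hcu, Finset.smul_sum]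
  simp only [map_smul]

theorem norm_square_le (hΦ : IsBand C Φ) {N : ℕ} {u : lp G 2} (hu : ∀ m, N ≤ m → u m = 0) :
    ‖square Φ u‖ ≤ 2 * C * (N + 1) * ‖u‖ := by
  have hC := hΦ.nonneg
  refine norm_le_of_inner_eq_sum Φ (by positivity) (hΦ.inner_square hu) fun v => ?_
  have h := hΦ.sum_norm_sq_le (N + 1) v
  push_cast at h
  exact h

theorem inner_square_symm (hΦ : IsBand C Φ) {N M : ℕ} {u v : lp G 2}
    (hu : ∀ m, N ≤ m → u m = 0) (hv : ∀ m, M ≤ m → v m = 0) :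
    inner ℂ (square Φ u) v = inner ℂ u (square Φ v) := by
  rw [hΦ.inner_square (N := max N M) fun m hm => hu m (le_of_max_le_left hm),
    ← inner_conj_symm u,
    hΦ.inner_square (N := max N M) fun m hm => hv m (le_of_max_le_right hm), map_sum]
  exact Finset.sum_congr rfl fun n _ => (inner_conj_symm _ _).symm

end IsBand

end Band

/-! ### Assembly of the smeared field operator on the Fock space -/

section Levels

variable {d : ℕ}

/-- The component with `n` particles, as an element of the tensor power. -/
def level (n : ℕ) : Fock d →L[ℂ] TensorPow d n :=
  (antisymm d n).subtypeL ∘L lp.evalCLM ℂ (fun n : ℕ => antisymm d n) 2 n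

theorem level_apply (n : ℕ) (u : Fock d) : level n u = (u n : TensorPow d n) := rfl

theorem norm_level (n : ℕ) (u : Fock d) : ‖level n u‖ = ‖u n‖ := rfl

end Levels

/-- The target of the smeared field operator: square integrable functions of a position `x` in
space and of `n` particles. -/
abbrev FieldSpace (d n : ℕ) : Type :=
  PiLp 2 (fun _ : Fin n → Fin 2 => Lp ℂ 2 (volume : Measure (Space d × (Fin n → Space d))))

/-- One-particle building blocks of a smeared field operator `x ↦ w (x) ψ (x)`. -/
structure FieldKernels (d : ℕ) where
  /-- Annihilation of the first particle. -/
  ann : ∀ n, Lp ℂ 2 (volume : Measure (Fin (n + 1) → Space d)) →L[ℂ]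
    Lp ℂ 2 (volume : Measure (Space d × (Fin n → Space d)))
  /-- Creation of the `i`-th particle. -/
  cre : ∀ n, Fin (n + 1) → Lp ℂ 2 (volume : Measure (Fin n → Space d)) →L[ℂ]
    Lp ℂ 2 (volume : Measure (Space d × (Fin (n + 1) → Space d)))
  /-- A common bound. -/
  bound : ℝ
  bound_nonneg : 0 ≤ bound
  norm_ann_le : ∀ n u, ‖ann n u‖ ≤ bound * ‖u‖
  norm_cre_le : ∀ n i u, ‖cre n i u‖ ≤ bound * ‖u‖

namespace FieldKernels

variable {d : ℕ} (𝒦 : FieldKernels d)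

/-- The annihilation part of the smeared field operator. -/
def annPart (n : ℕ) : TensorPow d (n + 1) →L[ℂ] FieldSpace d n :=
  ((√((n : ℝ) + 1) : ℝ) : ℂ) •
    relabel (𝒦.ann n) (fun s => (Fin.cons (1 : Fin 2) s : Fin (n + 1) → Fin 2)) (fun _ => True)

/-- The creation part of the smeared field operator. -/
def crePart (n : ℕ) : TensorPow d n →L[ℂ] FieldSpace d (n + 1) :=
  ((1 / √((n : ℝ) + 1) : ℝ) : ℂ) • ∑ i : Fin (n + 1), ((-1 : ℂ) ^ (i : ℕ)) •
    relabel (𝒦.cre n i) (fun s => s ∘ i.succAbove) (fun s => s i = 0)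

theorem norm_annPart_le (n : ℕ) (u : TensorPow d (n + 1)) :
    ‖𝒦.annPart n u‖ ≤ 𝒦.bound * √((n : ℝ) + 1) * ‖u‖ := by
  rw [annPart, smul_apply, norm_smul, Complex.norm_real, Real.norm_eq_abs,
    abs_of_nonneg (Real.sqrt_nonneg _), mul_comm 𝒦.bound, mul_assoc]
  gcongr
  exact norm_relabel_le _ (Set.injOn_of_injective (Fin.cons_right_injective _)) 𝒦.bound_nonneg
    (𝒦.norm_ann_le n) u

/-- There are `n + 1` terms of norm at most `bound * ‖u‖`, and the prefactor `1 / √(n + 1)` leaves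
`√(n + 1)`. The triangle inequality suffices, so the antisymmetry of `u` is not involved. -/
theorem norm_crePart_le (n : ℕ) (u : TensorPow d n) :
    ‖𝒦.crePart n u‖ ≤ 𝒦.bound * √((n : ℝ) + 1) * ‖u‖ := by
  have hn : (0 : ℝ) < √((n : ℝ) + 1) := Real.sqrt_pos.mpr (by positivity)
  have h1 : ∀ i : Fin (n + 1), ‖(((-1 : ℂ) ^ (i : ℕ)) •
      relabel (𝒦.cre n i) (fun s : Fin (n + 1) → Fin 2 => s ∘ i.succAbove) (fun s => s i = 0)) u‖ ≤
        𝒦.bound * ‖u‖ := by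
    intro i
    rw [smul_apply, norm_smul, norm_pow, norm_neg, norm_one, one_pow, one_mul]
    refine norm_relabel_le _ ?_ 𝒦.bound_nonneg (𝒦.norm_cre_le n i) u
    -- Erasing the `i`-th label loses nothing, since it is known to be `0`.
    intro s hs t ht hst
    funext j
    rcases eq_or_ne j i with rfl | hj
    · exact (show s j = 0 from hs).trans (show t j = 0 from ht).symm
    · obtain ⟨k, rfl⟩ := Fin.exists_succAbove_eq hj
      exact congrFun hst k
  rw [crePart, smul_apply, norm_smul, Complex.norm_real, Real.norm_eq_abs,
    abs_of_nonneg (by positivity), sum_apply, one_div_mul_eq_div,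
    div_le_iff₀ hn]
  refine (norm_sum_le_of_le _ fun i _ => h1 i).trans_eq ?_
  rw [Finset.sum_const, Finset.card_univ, Fintype.card_fin, nsmul_eq_mul]
  have h2 : √((n : ℝ) + 1) * √((n : ℝ) + 1) = n + 1 := Real.mul_self_sqrt (by positivity)
  push_cast
  linear_combination (-𝒦.bound * ‖u‖) * h2

/-- The component with `n` particles of the smeared field operator `x ↦ w (x) ψ (x)`. -/
def field : ∀ n : ℕ, Fock d →L[ℂ] FieldSpace d n
  | 0 => 𝒦.annPart 0 ∘L level 1
  | n + 1 => 𝒦.annPart (n + 1) ∘L level (n + 2) + 𝒦.crePart n ∘L level n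

theorem field_eq_zero {n : ℕ} {u : Fock d} (h1 : u (n + 1) = 0)
    (h2 : ∀ m, n = m + 1 → u m = 0) : 𝒦.field n u = 0 := by
  cases n with
  | zero => simp [field, level_apply, h1]
  | succ n => simp [field, level_apply, h1, h2 n rfl]

theorem norm_field_sq_le (n : ℕ) (u : Fock d) :
    ‖𝒦.field n u‖ ^ 2 ≤ 2 * 𝒦.bound ^ 2 * (n + 1) * (‖u (n + 1)‖ ^ 2 + prevNormSq u n) := by
  cases n with
  | zero =>
    have h := pow_le_pow_left₀ (norm_nonneg _) (𝒦.norm_annPart_le 0 (level 1 u)) 2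
    rw [norm_level, mul_pow, mul_pow, Real.sq_sqrt (by positivity)] at h
    have h0 : ‖𝒦.field 0 u‖ ^ 2 = ‖𝒦.annPart 0 (level 1 u)‖ ^ 2 := rfl
    rw [h0]
    refine h.trans (le_of_sub_nonneg ?_)
    have hp : prevNormSq u 0 = 0 := rfl
    rw [hp]
    have h1 : 0 ≤ 𝒦.bound ^ 2 * ‖u 1‖ ^ 2 := by positivity
    generalize hx : ‖u 1‖ = x at *
    push_cast
    linarith
  | succ n =>
    have h := norm_add_sq_le_of_le (𝒦.norm_annPart_le (n + 1) (level (n + 2) u))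
      (𝒦.norm_crePart_le n (level n u))
    rwa [norm_level, norm_level] at h

theorem isBand_field : IsBand (2 * 𝒦.bound ^ 2) 𝒦.field where
  nonneg := by positivity
  eq_zero _ _ h1 h2 := 𝒦.field_eq_zero h1 h2
  norm_sq_le := 𝒦.norm_field_sq_le

theorem square_mem {u : Fock d} (hu : u ∈ fockFin d) : IsBand.square 𝒦.field u ∈ fockFin d := by
  obtain ⟨N, hN⟩ := hu
  exact ⟨N + 2, fun m hm => 𝒦.isBand_field.square_apply_eq_zero hN hm⟩

theorem square_add {u v : Fock d} (hu : u ∈ fockFin d) (hv : v ∈ fockFin d) :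
    IsBand.square 𝒦.field (u + v) = IsBand.square 𝒦.field u + IsBand.square 𝒦.field v := by
  obtain ⟨N, hN⟩ := hu
  obtain ⟨M, hM⟩ := hv
  exact 𝒦.isBand_field.square_add hN hM

theorem square_smul {u : Fock d} (hu : u ∈ fockFin d) (c : ℂ) :
    IsBand.square 𝒦.field (c • u) = c • IsBand.square 𝒦.field u := by
  obtain ⟨N, hN⟩ := hu
  exact 𝒦.isBand_field.square_smul hN c

theorem inner_square_symm {u v : Fock d} (hu : u ∈ fockFin d) (hv : v ∈ fockFin d) :
    inner ℂ (IsBand.square 𝒦.field u) v = inner ℂ u (IsBand.square 𝒦.field v) := by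
  obtain ⟨N, hN⟩ := hu
  obtain ⟨M, hM⟩ := hv
  exact 𝒦.isBand_field.inner_square_symm hN hM

/-- The smeared density `∫ w (x)² ψ* (x) ψ (x) dx` on the finite-particle vectors. -/
def smeared : Module.End ℂ (fockFin d) where
  toFun u := ⟨IsBand.square 𝒦.field (u : Fock d), 𝒦.square_mem u.2⟩
  map_add' u v := Subtype.ext (𝒦.square_add u.2 v.2)
  map_smul' c u := Subtype.ext (𝒦.square_smul u.2 c)

theorem inner_smeared_symm (u v : fockFin d) :
    inner ℂ (𝒦.smeared u : Fock d) (v : Fock d) = inner ℂ (u : Fock d) (𝒦.smeared v : Fock d) :=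
  𝒦.inner_square_symm u.2 v.2

end FieldKernels

/-! ### Uniqueness of operators bounded on each particle number -/

section Generic

variable {A : ℕ → Type*} [∀ n, NormedAddCommGroup (A n)] [∀ n, NormedSpace ℂ (A n)]
  {V H : Type*} [AddCommGroup V] [Module ℂ V] [NormedAddCommGroup H] [NormedSpace ℂ H]

/-- Linear maps that are bounded on each level are determined by their values on total subsets of
the levels. -/
theorem linearMap_eq_of_levels {R R' : V →ₗ[ℂ] H} (ι : ∀ n, A n →ₗ[ℂ] V)
    (hι : ∀ u : V, ∃ (N : ℕ) (a : ∀ n, A n), u = ∑ n ∈ Finset.range N, ι n (a n))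
    (hR : ∀ n, ∃ C : ℝ, ∀ a, ‖R (ι n a)‖ ≤ C * ‖a‖)
    (hR' : ∀ n, ∃ C : ℝ, ∀ a, ‖R' (ι n a)‖ ≤ C * ‖a‖) {S : ∀ n, Set (A n)}
    (hS : ∀ n, Dense (Submodule.span ℂ (S n) : Set (A n)))
    (h : ∀ n, ∀ a ∈ S n, R (ι n a) = R' (ι n a)) (u : V) : R u = R' u := by
  have h1 : ∀ (n : ℕ) (a : A n), R (ι n a) = R' (ι n a) := by
    intro n a
    obtain ⟨C, hC⟩ := hR n
    obtain ⟨C', hC'⟩ := hR' n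
    have hL : LinearMap.mkContinuous (R ∘ₗ ι n) C hC = LinearMap.mkContinuous (R' ∘ₗ ι n) C' hC' :=
      ContinuousLinearMap.ext_on (hS n) (h n)
    exact DFunLike.congr_fun hL a
  obtain ⟨N, a, rfl⟩ := hι u
  rw [map_sum, map_sum]
  exact Finset.sum_congr rfl fun n _ => h1 n _

theorem sub_apply_eq_zero_and_norm_le {G : ℕ → Type*} [∀ n, NormedAddCommGroup (G n)]
    [∀ n, InnerProductSpace ℂ (G n)] {x y : lp G 2} {M M' : ℕ} {C C' r : ℝ}
    (hx : (∀ n, M ≤ n → x n = 0) ∧ ‖x‖ ≤ C * r) (hy : (∀ n, M' ≤ n → y n = 0) ∧ ‖y‖ ≤ C' * r) :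
    (∀ n, max M M' ≤ n → (x - y) n = 0) ∧ ‖x - y‖ ≤ (C + C') * r := by
  refine ⟨fun n hn => ?_, ?_⟩
  · rw [lp.coeFn_sub, Pi.sub_apply, hx.1 n (le_of_max_le_left hn),
      hy.1 n (le_of_max_le_right hn), sub_zero]
  · rw [add_mul]
    exact (norm_sub_le _ _).trans (add_le_add hx.2 hy.2)

end Generic

/-! ### Totality of the test vectors and uniqueness of the smeared density -/

section Totality

variable {d : ℕ}

/-- The vector with the only component `a`, with `n` particles. -/
def single (n : ℕ) (a : antisymm d n) : Fock d := lp.single (E := fun n : ℕ => antisymm d n) 2 n a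

theorem single_self (n : ℕ) (a : antisymm d n) : single n a n = a :=
  lp.single_apply_self (E := fun n : ℕ => antisymm d n) 2 n a

theorem single_of_ne {n m : ℕ} (a : antisymm d n) (h : m ≠ n) : single n a m = 0 :=
  lp.single_apply_ne (E := fun n : ℕ => antisymm d n) 2 n a h

theorem norm_single (n : ℕ) (a : antisymm d n) : ‖single n a‖ = ‖a‖ :=
  lp.norm_single (E := fun n : ℕ => antisymm d n) (by simp) n a

theorem inner_single_right (u : Fock d) (n : ℕ) (a : antisymm d n) :
    inner ℂ u (single n a) = inner ℂ (u n) a :=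
  lp.inner_single_right (𝕜 := ℂ) (G := fun n : ℕ => antisymm d n) n a u

theorem single_mem (n : ℕ) (a : antisymm d n) : single n a ∈ fockFin d :=
  ⟨n + 1, fun _ hm => single_of_ne a (by omega)⟩

/-- Permutation of the particles of a Schwartz function. -/
def permSchwartz {n : ℕ} (π : Equiv.Perm (Fin n)) :
    𝓢(Fin n → Space d, ℂ) →L[ℂ] 𝓢(Fin n → Space d, ℂ) :=
  SchwartzMap.compCLMOfContinuousLinearEquiv ℂ
    (LinearEquiv.funCongrLeft ℝ (Space d) π).toContinuousLinearEquiv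

theorem permSchwartz_apply {n : ℕ} (π : Equiv.Perm (Fin n)) (h : 𝓢(Fin n → Space d, ℂ))
    (y : Fin n → Space d) : permSchwartz π h y = h (y ∘ π) := rfl

/-- The antisymmetrization of the Schwartz function `h` of particles with labels `s`. -/
def alternate {n : ℕ} (s : Fin n → Fin 2) (h : 𝓢(Fin n → Space d, ℂ)) (t : Fin n → Fin 2) :
    𝓢(Fin n → Space d, ℂ) :=
  ∑ π : Equiv.Perm (Fin n), ((Equiv.Perm.sign π : ℤ) : ℂ) •
    if t ∘ π = s then permSchwartz π h else 0

theorem alternate_apply {n : ℕ} (s : Fin n → Fin 2) (h : 𝓢(Fin n → Space d, ℂ))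
    (t : Fin n → Fin 2) (y : Fin n → Space d) :
    alternate s h t y = ∑ π : Equiv.Perm (Fin n), ((Equiv.Perm.sign π : ℤ) : ℂ) *
      if t ∘ π = s then h (y ∘ π) else 0 := by
  rw [alternate, sum_apply]
  refine Finset.sum_congr rfl fun π _ => ?_
  rw [smul_apply, smul_eq_mul]
  split_ifs <;> simp [permSchwartz_apply]

theorem alternate_perm {n : ℕ} (s : Fin n → Fin 2) (h : 𝓢(Fin n → Space d, ℂ))
    (ρ : Equiv.Perm (Fin n)) (t : Fin n → Fin 2) (y : Fin n → Space d) :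
    alternate s h (t ∘ ρ) (y ∘ ρ) = ((Equiv.Perm.sign ρ : ℤ) : ℂ) * alternate s h t y := by
  rw [alternate_apply, alternate_apply, Finset.mul_sum]
  refine Fintype.sum_equiv (Equiv.mulLeft ρ) _ _ fun π => ?_
  have h1 : ((Equiv.Perm.sign ρ : ℤ) : ℂ) * ((Equiv.Perm.sign ρ : ℤ) : ℂ) = 1 := by
    rw [← Int.cast_mul, ← Units.val_mul, Int.units_mul_self]
    simp
  have h2 : t ∘ ρ ∘ π = t ∘ (ρ * π : Equiv.Perm (Fin n)) := rfl
  have h3 : y ∘ ρ ∘ π = y ∘ (ρ * π : Equiv.Perm (Fin n)) := rfl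
  rw [Equiv.coe_mulLeft, Equiv.Perm.sign_mul, Units.val_mul, Int.cast_mul, Function.comp_assoc,
    Function.comp_assoc, h2, h3]
  linear_combination (-((Equiv.Perm.sign π : ℤ) : ℂ) *
    (if t ∘ (ρ * π : Equiv.Perm (Fin n)) = s then h (y ∘ (ρ * π : Equiv.Perm (Fin n))) else 0)) * h1

/-- The test vector with `n` particles whose component is `alternate s h`. -/
def alternateTest {n : ℕ} (s : Fin n → Fin 2) (h : 𝓢(Fin n → Space d, ℂ)) : TestVector d where
  toFun := Pi.single (M := fun m => (Fin m → Fin 2) → 𝓢(Fin m → Space d, ℂ)) n (alternate s h)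
  antisymm' m π t y := by
    rcases eq_or_ne m n with rfl | hm
    · rw [Pi.single_eq_same]
      exact alternate_perm s h π t y
    · rw [Pi.single_eq_of_ne hm]
      simp
  finite' := ⟨n + 1, fun m hm => Pi.single_eq_of_ne (by omega) _⟩

theorem alternateTest_toFock {n : ℕ} (s : Fin n → Fin 2) (h : 𝓢(Fin n → Space d, ℂ)) :
    ((alternateTest s h).toFock : Fock d) = single n ((alternateTest s h).component n) := by
  refine lp.ext (funext fun m => ?_)
  rcases eq_or_ne m n with rfl | hm
  · rw [single_self]
    rfl
  · rw [single_of_ne _ hm]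
    exact TestVector.component_eq_zero _ (Pi.single_eq_of_ne hm _)

/-- Permutation of the particles as an isometry of `L²`. -/
def permLp {n : ℕ} (π : Equiv.Perm (Fin n)) : Lp ℂ 2 (volume : Measure (Fin n → Space d)) →ₗᵢ[ℂ]
    Lp ℂ 2 (volume : Measure (Fin n → Space d)) :=
  Lp.compMeasurePreservingₗᵢ ℂ _ (measurePreserving_perm d π)

theorem permLp_toLp {n : ℕ} (π : Equiv.Perm (Fin n)) (h : 𝓢(Fin n → Space d, ℂ)) :
    (permSchwartz π h).toLp 2 = permLp π (h.toLp 2) := by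
  apply Lp.ext
  refine (SchwartzMap.coeFn_toLp (permSchwartz π h) 2 volume).trans ?_
  have hp := measurePreserving_perm d π
  refine (Filter.EventuallyEq.trans (Lp.coeFn_compMeasurePreserving (h.toLp 2) hp) ?_).symm
  exact hp.quasiMeasurePreserving.ae_eq_comp (SchwartzMap.coeFn_toLp h 2 volume)

/-- The permutation is an isometry of `L²` that carries the component `s` of `v` to `sign π` times
its component `t`. -/
theorem inner_perm_term {n : ℕ} (v : antisymm d n) (s t : Fin n → Fin 2)
    (h : 𝓢(Fin n → Space d, ℂ)) (π : Equiv.Perm (Fin n)) (hts : t ∘ π = s) :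
    inner ℂ ((v : TensorPow d n) t) ((permSchwartz π h).toLp 2 volume) =
      ((Equiv.Perm.sign π : ℤ) : ℂ) * inner ℂ ((v : TensorPow d n) s) (h.toLp 2 volume) := by
  have h1 : ((Equiv.Perm.sign π : ℤ) : ℂ) * ((Equiv.Perm.sign π : ℤ) : ℂ) = 1 := by
    rw [← Int.cast_mul, ← Units.val_mul, Int.units_mul_self]
    simp
  have h2 : permLp π ((v : TensorPow d n) s) =
      ((Equiv.Perm.sign π : ℤ) : ℂ) • (v : TensorPow d n) t := by
    rw [← hts]
    exact v.2 π t
  have h3 : inner ℂ (permLp π ((v : TensorPow d n) s)) (permLp π (h.toLp 2 volume)) =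
      inner ℂ ((v : TensorPow d n) s) (h.toLp 2 volume) := (permLp π).inner_map_map _ _
  rw [h2, inner_smul_left, map_intCast] at h3
  rw [permLp_toLp, ← h3, ← mul_assoc, h1, one_mul]

theorem toLp_alternate {n : ℕ} (s : Fin n → Fin 2) (h : 𝓢(Fin n → Space d, ℂ))
    (t : Fin n → Fin 2) :
    (alternate s h t).toLp 2 volume = ∑ π : Equiv.Perm (Fin n), ((Equiv.Perm.sign π : ℤ) : ℂ) •
      if t ∘ π = s then (permSchwartz π h).toLp 2 volume else 0 := by
  have h1 : (alternate s h t).toLp 2 volume =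
    SchwartzMap.toLpCLM ℂ ℂ 2 volume (alternate s h t) := rfl
  rw [h1, alternate, map_sum]
  refine Finset.sum_congr rfl fun π _ => ?_
  rw [map_smul]
  split_ifs
  · rfl
  · rw [map_zero]

/-- Against an antisymmetric vector the `n!` permutations all contribute equally, the two signs
cancelling. So antisymmetrized test functions detect every component of `v` separately. -/
theorem inner_alternate {n : ℕ} (v : antisymm d n) (s : Fin n → Fin 2)
    (h : 𝓢(Fin n → Space d, ℂ)) :
    inner ℂ v ((alternateTest s h).component n) =
      (n.factorial : ℂ) * inner ℂ ((v : TensorPow d n) s) (h.toLp 2 volume) := by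
  have h0 : ∀ t, ((alternateTest s h).component n : TensorPow d n) t =
      (alternate s h t).toLp 2 volume := by
    intro t
    have h1 : (alternateTest s h).toFun n = alternate s h := Pi.single_eq_same _ _
    change ((alternateTest s h).toFun n t).toLp 2 volume = _
    rw [h1]
  rw [Submodule.coe_inner, PiLp.inner_apply]
  simp_rw [h0, toLp_alternate, inner_sum]
  rw [Finset.sum_comm]
  have h2 : ∀ π : Equiv.Perm (Fin n), ∑ t : Fin n → Fin 2,
      inner ℂ ((v : TensorPow d n) t) (((Equiv.Perm.sign π : ℤ) : ℂ) •
        if t ∘ π = s then (permSchwartz π h).toLp 2 volume else 0) =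
      inner ℂ ((v : TensorPow d n) s) (h.toLp 2 volume) := by
    intro π
    have h1 : ((Equiv.Perm.sign π : ℤ) : ℂ) * ((Equiv.Perm.sign π : ℤ) : ℂ) = 1 := by
      rw [← Int.cast_mul, ← Units.val_mul, Int.units_mul_self]
      simp
    have hs : (s ∘ π.symm) ∘ π = s := by
      funext i; simp
    -- For each permutation exactly one label family `t` satisfies `t ∘ π = s`.
    rw [Finset.sum_eq_single (s ∘ π.symm)]
    · rw [if_pos hs, inner_smul_right, inner_perm_term v s _ h π hs, ← mul_assoc, h1, one_mul]
    · intro t _ ht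
      rw [if_neg, smul_zero, inner_zero_right]
      rintro rfl
      exact ht (by funext i; simp)
    · simp
  rw [Finset.sum_congr rfl fun π _ => h2 π, Finset.sum_const, Finset.card_univ,
    Fintype.card_perm, Fintype.card_fin, nsmul_eq_mul]

theorem eq_zero_of_inner_alternate {n : ℕ} (v : antisymm d n)
    (hv : ∀ (s : Fin n → Fin 2) (h : 𝓢(Fin n → Space d, ℂ)),
      inner ℂ v ((alternateTest s h).component n) = 0) : v = 0 := by
  have h1 : ∀ s, (v : TensorPow d n) s = 0 := by
    intro s
    have hd : DenseRange (SchwartzMap.toLpCLM ℂ ℂ 2 (volume : Measure (Fin n → Space d))) :=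
      SchwartzMap.denseRange_toLpCLM ENNReal.ofNat_ne_top
    refine hd.eq_zero_of_inner_left (𝕜 := ℂ) ?_
    intro h
    have h2 := hv s h
    rw [inner_alternate] at h2
    exact (mul_eq_zero.mp h2).resolve_left (by exact_mod_cast n.factorial_ne_zero)
  apply Subtype.ext
  ext1 s
  exact h1 s

/-- The test vectors are total in the Fock space. -/
theorem eq_zero_of_inner_toFock {u : Fock d}
    (hu : ∀ G : TestVector d, inner ℂ u (G.toFock : Fock d) = 0) : u = 0 := by
  refine lp.ext (funext fun n => eq_zero_of_inner_alternate _ fun s h => ?_)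
  rw [← inner_single_right, ← alternateTest_toFock]
  exact hu _

theorem eq_sum_single {u : Fock d} {N : ℕ} (hu : ∀ n, N ≤ n → u n = 0) :
    u = ∑ n ∈ Finset.range N, single n (u n) := by
  refine lp.ext (funext fun m => ?_)
  rw [lp.coeFn_sum, Finset.sum_apply]
  by_cases hm : m < N
  · rw [Finset.sum_eq_single m, single_self]
    · intro n _ hn
      exact single_of_ne _ hn.symm
    · intro h
      exact absurd (Finset.mem_range.mpr hm) h
  · rw [hu m (not_lt.mp hm)]
    refine (Finset.sum_eq_zero fun n hn => single_of_ne _ ?_).symm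
    rw [Finset.mem_range] at hn
    omega

theorem single_add (n : ℕ) (a b : antisymm d n) : single n (a + b) = single n a + single n b :=
  lp.single_add (E := fun n : ℕ => antisymm d n) 2 n a b

theorem single_smul (n : ℕ) (c : ℂ) (a : antisymm d n) : single n (c • a) = c • single n a :=
  lp.single_smul (E := fun n : ℕ => antisymm d n) 2 n c a

/-- The embedding of the `n`-particle space. -/
def singleFin (n : ℕ) : antisymm d n →ₗ[ℂ] fockFin d where
  toFun a := ⟨single n a, single_mem n a⟩
  map_add' a b := Subtype.ext (single_add n a b)
  map_smul' c a := Subtype.ext (single_smul n c a)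

theorem singleFin_coe (n : ℕ) (a : antisymm d n) : (singleFin n a : Fock d) = single n a := rfl

theorem exists_eq_sum_singleFin (u : fockFin d) :
    ∃ (N : ℕ) (a : ∀ n, antisymm d n), u = ∑ n ∈ Finset.range N, singleFin n (a n) := by
  refine Exists.elim u.2 fun N hN => ⟨N, fun n => (u : Fock d) n, Subtype.ext ?_⟩
  rw [Submodule.coe_sum]
  exact eq_sum_single hN

theorem IsFinContinuous.exists_bound {R : Module.End ℂ (fockFin d)} (hR : IsFinContinuous R)
    (n : ℕ) : ∃ C : ℝ, ∀ a, ‖((fockFin d).subtype ∘ₗ R) (singleFin n a)‖ ≤ C * ‖a‖ := by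
  refine Exists.elim (hR (n + 1)) fun M hM => Exists.elim hM fun C hMC => ⟨C, fun a => ?_⟩
  have h2 := (hMC (singleFin n a) fun m hm => single_of_ne a (by omega)).2
  rw [singleFin_coe, norm_single] at h2
  exact h2

theorem alternate_span_dense (n : ℕ) :
    Dense (Submodule.span ℂ (Set.range fun p : (Fin n → Fin 2) × 𝓢(Fin n → Space d, ℂ) =>
      (alternateTest p.1 p.2).component n) : Set (antisymm d n)) := by
  rw [Submodule.dense_iff_topologicalClosure_eq_top, Submodule.topologicalClosure_eq_top_iff,
    Submodule.eq_bot_iff]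
  intro v hv
  exact eq_zero_of_inner_alternate v fun s g =>
    Submodule.inner_left_of_mem_orthogonal
      (Submodule.subset_span (Set.mem_range.mpr ⟨(s, g), rfl⟩)) hv

theorem singleFin_component {n : ℕ} (s : Fin n → Fin 2) (g : 𝓢(Fin n → Space d, ℂ)) :
    singleFin n ((alternateTest s g).component n) = (alternateTest s g).toFock :=
  Subtype.ext (alternateTest_toFock s g).symm

/-- A continuous operator on the finite-particle vectors is determined by its values at test
vectors. -/
theorem IsFinContinuous.eq_of_toFock {R R' : Module.End ℂ (fockFin d)} (hR : IsFinContinuous R)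
    (hR' : IsFinContinuous R') (h : ∀ G : TestVector d, R G.toFock = R' G.toFock) : R = R' := by
  refine LinearMap.ext fun u => Subtype.ext ?_
  refine linearMap_eq_of_levels (R := (fockFin d).subtype ∘ₗ R) (R' := (fockFin d).subtype ∘ₗ R')
    singleFin exists_eq_sum_singleFin hR.exists_bound hR'.exists_bound alternate_span_dense ?_ u
  rintro n _ ⟨p, rfl⟩
  exact congrArg Subtype.val ((congrArg R (singleFin_component p.1 p.2)).trans
    ((h _).trans (congrArg R' (singleFin_component p.1 p.2)).symm))

theorem IsSmearedDensity.unique {khat : Space d → ℝ} {hk : Integrable khat volume}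
    {f : 𝓢(Space d, ℝ)} {R R' : Module.End ℂ (fockFin d)} (hR : IsSmearedDensity khat hk f R)
    (hR' : IsSmearedDensity khat hk f R') : R = R' := by
  refine hR.1.eq_of_toFock hR'.1 fun G => ?_
  refine Subtype.ext (sub_eq_zero.mp (eq_zero_of_inner_toFock fun G' => ?_))
  exact (inner_sub_left _ _ _).trans
    (sub_eq_zero.mpr ((hR.2 G G').2.trans (hR'.2 G G').2.symm))

end Totality

/-! ### Matrix elements of the smeared density between test vectors -/

section

variable {d : ℕ}

/-- The component of a test vector with `n` particles, as an element of the tensor power. -/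
def TestVector.tensor (G : TestVector d) (n : ℕ) : TensorPow d n :=
  WithLp.toLp 2 fun s => (G.toFun n s).toLp 2 volume

/-- The kernels are those of the field operator `ψ (x)`, smeared with the weight `w`. -/
structure FieldKernels.Represents (𝒦 : FieldKernels d) (khat : Space d → ℝ)
    (hk : Integrable khat volume) (w : Space d → ℝ) : Prop where
  ann_ae : ∀ (n : ℕ) (h : 𝓢(Fin (n + 1) → Space d, ℂ)),
    𝒦.ann n (h.toLp 2) =ᵐ[volume] annihilateKernel khat w h
  cre_ae : ∀ (n : ℕ) (i : Fin (n + 1)) (h : 𝓢(Fin n → Space d, ℂ)),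
    𝒦.cre n i (h.toLp 2) =ᵐ[volume] createKernel (kappaOne khat hk) w i h

theorem FieldKernels.exists_represents {khat : Space d → ℝ} (hk : Integrable khat volume)
    (hk_nonneg : ∀ᵐ p ∂(volume : Measure (Space d)), 0 ≤ khat p) {w : Space d → ℝ} {C : ℝ}
    (hwm : Measurable w) (hwC : ∀ x, |w x| ≤ C) (hw : MemLp (fun x => (w x : ℂ)) 2 volume) :
    ∃ 𝒦 : FieldKernels d, 𝒦.Represents khat hk w := by
  choose A hA hA' using exists_annihilate_extension hk hk_nonneg hwm hwC
  choose B hB hB' using exists_create_extension (kappaOne khat hk) hwm hw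
  set b := (eLpNorm (fun x => (w x : ℂ)) 2 volume * eLpNorm (kappaOne khat hk) 2 volume).toReal
  refine ⟨⟨A, B, max C b, le_max_of_le_right ENNReal.toReal_nonneg, fun n u => ?_,
    fun n i u => ?_⟩, hA', hB'⟩
  · exact (hA n u).trans (mul_le_mul_of_nonneg_right (le_max_left _ _) (norm_nonneg _))
  · exact (hB n i u).trans (mul_le_mul_of_nonneg_right (le_max_right _ _) (norm_nonneg _))

namespace FieldKernels.Represents

variable {𝒦 : FieldKernels d} {khat : Space d → ℝ} {hk : Integrable khat volume} {w : Space d → ℝ}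

theorem annPart_ae (h𝒦 : 𝒦.Represents khat hk w) (G : TestVector d) (n : ℕ)
    (s : Fin n → Fin 2) : 𝒦.annPart n (G.tensor (n + 1)) s =ᵐ[volume]
      fun p => w p.1 * annihilateTwo khat p.1 G n s p.2 := by
  have h1 : 𝒦.annPart n (G.tensor (n + 1)) s = ((√((n : ℝ) + 1) : ℝ) : ℂ) •
      𝒦.ann n ((G.toFun (n + 1) (Fin.cons (1 : Fin 2) s : Fin (n + 1) → Fin 2)).toLp 2) := by
    rw [FieldKernels.annPart, smul_apply, PiLp.smul_apply, relabel_apply, if_pos trivial]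
    rfl
  rw [h1]
  refine (Lp.coeFn_smul _ _).trans ?_
  filter_upwards [h𝒦.ann_ae n (G.toFun (n + 1) (Fin.cons (1 : Fin 2) s : Fin (n + 1) → Fin 2))]
    with p hp
  rw [Pi.smul_apply, hp, annihilateKernel, slice_coe, annihilateTwo, smul_eq_mul]
  ring

theorem crePart_ae (h𝒦 : 𝒦.Represents khat hk w) (G : TestVector d) (n : ℕ)
    (s : Fin (n + 1) → Fin 2) : 𝒦.crePart n (G.tensor n) s =ᵐ[volume]
      fun p => w p.1 * createOne khat hk p.1 G (n + 1) s p.2 := by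
  have h1 : 𝒦.crePart n (G.tensor n) s = ((1 / √((n : ℝ) + 1) : ℝ) : ℂ) •
      ∑ i : Fin (n + 1), ((-1 : ℂ) ^ (i : ℕ)) •
        if s i = 0 then 𝒦.cre n i ((G.toFun n (s ∘ i.succAbove)).toLp 2) else 0 := by
    rw [FieldKernels.crePart, smul_apply, PiLp.smul_apply, sum_apply, WithLp.ofLp_sum,
      Finset.sum_apply]
    refine congrArg _ (Finset.sum_congr rfl fun i _ => ?_)
    rw [smul_apply, PiLp.smul_apply, relabel_apply]
    rfl
  have h2 : ∀ i : Fin (n + 1), (((-1 : ℂ) ^ (i : ℕ)) •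
      if s i = 0 then 𝒦.cre n i ((G.toFun n (s ∘ i.succAbove)).toLp 2) else 0 :
        Lp ℂ 2 (volume : Measure (Space d × (Fin (n + 1) → Space d)))) =ᵐ[volume]
      fun p => w p.1 * ((-1 : ℂ) ^ (i : ℕ) *
        (if s i = 0 then conj (kappaOne khat hk (p.2 i - p.1)) else 0) *
          G.toFun n (s ∘ i.succAbove) (p.2 ∘ i.succAbove)) := by
    intro i
    refine (Lp.coeFn_smul _ _).trans ?_
    split_ifs
    · filter_upwards [h𝒦.cre_ae n i (G.toFun n (s ∘ i.succAbove))] with p hp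
      rw [Pi.smul_apply, hp, createKernel, smul_eq_mul]
      ring
    · filter_upwards [Lp.coeFn_zero ℂ 2 (volume : Measure (Space d × (Fin (n + 1) → Space d)))]
        with p hp
      rw [Pi.smul_apply, hp]
      simp
  rw [h1]
  refine (Lp.coeFn_smul _ _).trans ?_
  filter_upwards [Lp.coeFn_finsetSum Finset.univ fun i : Fin (n + 1) => ((-1 : ℂ) ^ (i : ℕ)) •
      if s i = 0 then 𝒦.cre n i ((G.toFun n (s ∘ i.succAbove)).toLp 2) else 0,
    ae_all_iff.mpr h2] with p hp hp'
  rw [Pi.smul_apply, hp, Finset.sum_apply, Finset.sum_congr rfl fun i _ => hp' i, createOne,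
    smul_eq_mul, ← Finset.mul_sum]
  ring

/-- This links the `L²` extensions, known only up to null sets in the joint variable `(x, y)`, with
the pointwise formulas for `ψ(x)`. -/
theorem field_ae (h𝒦 : 𝒦.Represents khat hk w) (G : TestVector d) (n : ℕ)
    (s : Fin n → Fin 2) : 𝒦.field n (G.toFock : Fock d) s =ᵐ[volume]
      fun p => w p.1 * fieldOp khat hk p.1 G n s p.2 := by
  cases n with
  | zero =>
    have h1 : 𝒦.field 0 (G.toFock : Fock d) = 𝒦.annPart 0 (G.tensor 1) := rfl
    rw [h1]
    filter_upwards [h𝒦.annPart_ae G 0 s] with p hp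
    rw [hp, fieldOp, createOne, add_zero]
  | succ n =>
    have h1 : 𝒦.field (n + 1) (G.toFock : Fock d) =
      𝒦.annPart (n + 1) (G.tensor (n + 2)) + 𝒦.crePart n (G.tensor n) := rfl
    rw [h1, PiLp.add_apply]
    refine (Lp.coeFn_add _ _).trans ?_
    filter_upwards [h𝒦.annPart_ae G (n + 1) s, h𝒦.crePart_ae G n s] with p hp hp'
    rw [Pi.add_apply, hp, hp', fieldOp]
    ring

end FieldKernels.Represents

theorem fieldOp_eq_zero {khat : Space d → ℝ} {hk : Integrable khat volume} {G : TestVector d}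
    {N : ℕ} (hN : ∀ n, N ≤ n → G.toFun n = 0) (x : Space d) {n : ℕ} (hn : N + 1 ≤ n)
    (s : Fin n → Fin 2) (y : Fin n → Space d) : fieldOp khat hk x G n s y = 0 := by
  obtain ⟨n, rfl⟩ : ∃ m, n = m + 1 := ⟨n - 1, by omega⟩
  rw [fieldOp, annihilateTwo, createOne, hN (n + 1 + 1) (by omega), hN n (by omega)]
  have h1 : pairKappaTwo khat x (fun _ : Space d => (0 : ℂ)) = 0 := by
    have h2 := pairKappaTwo_smul khat x 0 (0 : 𝓢(Space d, ℂ))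
    rw [zero_mul] at h2
    refine Eq.trans (congrArg _ ?_) h2
    funext z
    simp
  simp [h1]

theorem densityForm_eq_sum {khat : Space d → ℝ} {hk : Integrable khat volume}
    {G₁ : TestVector d} {N : ℕ} (hN : ∀ n, N ≤ n → G₁.toFun n = 0) (G₂ : TestVector d)
    (x : Space d) : densityForm khat hk x G₁ G₂ =
      ∑ n ∈ Finset.range (N + 1), ∑ s : Fin n → Fin 2, ∫ y : Fin n → Space d,
        conj (fieldOp khat hk x G₁ n s y) * fieldOp khat hk x G₂ n s y := by
  refine tsum_eq_sum fun n hn => Finset.sum_eq_zero fun s _ => ?_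
  have h1 : ∀ y, fieldOp khat hk x G₁ n s y = 0 := fieldOp_eq_zero hN x (by simpa using hn) s
  simp [h1]

namespace FieldKernels.Represents

variable {𝒦 : FieldKernels d} {khat : Space d → ℝ} {hk : Integrable khat volume} {w : Space d → ℝ}

/-- A product of two `L²` functions of `(x, y)` is integrable, and Fubini gives both the absolute
convergence in `x` and the iterated form of the scalar product. -/
theorem integrable_inner_field (h𝒦 : 𝒦.Represents khat hk w) (G₁ G₂ : TestVector d) (n : ℕ)
    (s : Fin n → Fin 2) :
    Integrable (fun x => ((w x ^ 2 : ℝ) : ℂ) * ∫ y : Fin n → Space d,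
        conj (fieldOp khat hk x G₁ n s y) * fieldOp khat hk x G₂ n s y) volume ∧
      inner ℂ (𝒦.field n (G₁.toFock : Fock d) s) (𝒦.field n (G₂.toFock : Fock d) s) =
        ∫ x, ((w x ^ 2 : ℝ) : ℂ) * ∫ y : Fin n → Space d,
          conj (fieldOp khat hk x G₁ n s y) * fieldOp khat hk x G₂ n s y := by
  have h1 : (fun p => inner ℂ (𝒦.field n (G₁.toFock : Fock d) s p)
      (𝒦.field n (G₂.toFock : Fock d) s p)) =ᵐ[volume] fun p : Space d × (Fin n → Space d) =>
        ((w p.1 ^ 2 : ℝ) : ℂ) * (conj (fieldOp khat hk p.1 G₁ n s p.2) *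
          fieldOp khat hk p.1 G₂ n s p.2) := by
    filter_upwards [h𝒦.field_ae G₁ n s, h𝒦.field_ae G₂ n s] with p hp hp'
    rw [hp, hp', RCLike.inner_apply, map_mul, Complex.conj_ofReal]
    push_cast
    ring
  have h2 := (L2.integrable_inner (𝕜 := ℂ) (𝒦.field n (G₁.toFock : Fock d) s)
    (𝒦.field n (G₂.toFock : Fock d) s)).congr h1
  rw [L2.inner_def, integral_congr_ae h1]
  rw [Measure.volume_eq_prod] at h2 ⊢
  rw [integral_prod _ h2]
  have h3 := h2.integral_prod_left
  simp only [integral_const_mul] at h3 ⊢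
  exact ⟨h3, trivial⟩

theorem inner_smeared (h𝒦 : 𝒦.Represents khat hk w) (G₁ G₂ : TestVector d) :
    Integrable (fun x => ((w x ^ 2 : ℝ) : ℂ) * densityForm khat hk x G₁ G₂) volume ∧
      inner ℂ (𝒦.smeared G₁.toFock : Fock d) (G₂.toFock : Fock d) =
        ∫ x, ((w x ^ 2 : ℝ) : ℂ) * densityForm khat hk x G₁ G₂ := by
  obtain ⟨N, hN⟩ := G₁.finite'
  have h1 := fun n s => h𝒦.integrable_inner_field G₁ G₂ n s
  have h2 : inner ℂ (𝒦.smeared G₁.toFock : Fock d) (G₂.toFock : Fock d) =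
      ∑ n ∈ Finset.range (N + 1),
        inner ℂ (𝒦.field n (G₁.toFock : Fock d)) (𝒦.field n (G₂.toFock : Fock d)) :=
    𝒦.isBand_field.inner_square (fun m hm => G₁.component_eq_zero (hN m hm)) _
  rw [h2]
  simp_rw [densityForm_eq_sum hN, Finset.mul_sum, PiLp.inner_apply]
  refine ⟨integrable_finsetSum _ fun n _ => integrable_finsetSum _ fun s _ => (h1 n s).1, ?_⟩
  rw [integral_finsetSum _ fun n _ => integrable_finsetSum _ fun s _ => (h1 n s).1]
  refine Finset.sum_congr rfl fun n _ => ?_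
  rw [integral_finsetSum _ fun s _ => (h1 n s).1]
  exact Finset.sum_congr rfl fun s _ => (h1 n s).2

end FieldKernels.Represents

end

/-! ### Existence, symmetry and linear growth of the smeared density -/

section

theorem sub_apply_eq_zero_and_norm_le_of_same_level {G : ℕ → Type*} [∀ n, NormedAddCommGroup (G n)]
    [∀ n, InnerProductSpace ℂ (G n)] {x y : lp G 2} {M : ℕ} {c c' t r : ℝ}
    (hx : (∀ n, M ≤ n → x n = 0) ∧ ‖x‖ ≤ c * t * r)
    (hy : (∀ n, M ≤ n → y n = 0) ∧ ‖y‖ ≤ c' * t * r) :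
    (∀ n, M ≤ n → (x - y) n = 0) ∧ ‖x - y‖ ≤ (c + c') * t * r := by
  have h := sub_apply_eq_zero_and_norm_le hx hy
  rwa [max_self, ← add_mul] at h

variable {d : ℕ}

/-- Symmetry of an operator on the finite-particle vectors. -/
def IsSymmetricOp (R : Module.End ℂ (fockFin d)) : Prop :=
  ∀ u v : fockFin d, inner ℂ (R u : Fock d) (v : Fock d) = inner ℂ (u : Fock d) (R v : Fock d)

/-- The operator raises the number of particles by at most one, and its norm grows at most linearly
in the number of particles. -/
def HasLinearGrowth (c : ℝ) (R : Module.End ℂ (fockFin d)) : Prop :=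
  ∀ (N : ℕ) (u : fockFin d), (∀ n, N ≤ n → (u : Fock d) n = 0) →
    (∀ n, N + 2 ≤ n → (R u : Fock d) n = 0) ∧
      ‖(R u : Fock d)‖ ≤ c * ((N : ℝ) + 1) * ‖(u : Fock d)‖

theorem HasLinearGrowth.isFinContinuous {c : ℝ} {R : Module.End ℂ (fockFin d)}
    (hR : HasLinearGrowth c R) : IsFinContinuous R :=
  fun N => ⟨N + 2, c * ((N : ℝ) + 1), hR N⟩

theorem HasLinearGrowth.sub {c c' : ℝ} {R R' : Module.End ℂ (fockFin d)}
    (hR : HasLinearGrowth c R) (hR' : HasLinearGrowth c' R') : HasLinearGrowth (c + c') (R - R') :=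
  fun N u hu => sub_apply_eq_zero_and_norm_le_of_same_level (hR N u hu) (hR' N u hu)

theorem FieldKernels.hasLinearGrowth_smeared (𝒦 : FieldKernels d) :
    HasLinearGrowth (2 * (2 * 𝒦.bound ^ 2)) 𝒦.smeared := fun _ _ hu =>
  ⟨fun _ hn => 𝒦.isBand_field.square_apply_eq_zero hu hn, 𝒦.isBand_field.norm_square_le hu⟩

theorem memLp_sqrt_max (f : 𝓢(Space d, ℝ)) :
    MemLp (fun x => ((√(max (f x) 0) : ℝ) : ℂ)) 2 volume := by
  have hm : AEStronglyMeasurable (fun x => ((√(max (f x) 0) : ℝ) : ℂ)) volume :=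
    (Complex.continuous_ofReal.comp (Real.continuous_sqrt.comp
      (f.continuous.max continuous_const))).aestronglyMeasurable
  rw [memLp_two_iff_integrable_sq_norm hm]
  refine f.integrable.mono (hm.norm.pow 2) (Eventually.of_forall fun x => ?_)
  rw [Complex.norm_real, norm_pow, norm_norm, Real.norm_eq_abs, sq_abs,
    Real.sq_sqrt (le_max_right _ _), Real.norm_eq_abs]
  exact max_le (le_abs_self _) (abs_nonneg _)

theorem exists_represents_sqrt_max {khat : Space d → ℝ} (hk : Integrable khat volume)
    (hk_nonneg : ∀ᵐ p ∂(volume : Measure (Space d)), 0 ≤ khat p) (f : 𝓢(Space d, ℝ)) :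
    ∃ 𝒦 : FieldKernels d, 𝒦.Represents khat hk fun x => √(max (f x) 0) := by
  -- The zeroth Schwartz seminorm bounds `|f|`, so its square root bounds the weight.
  refine FieldKernels.exists_represents hk hk_nonneg
    (C := √(SchwartzMap.seminorm ℝ 0 0 f)) ?_ (fun x => ?_) (memLp_sqrt_max f)
  · exact (Real.continuous_sqrt.comp (f.continuous.max continuous_const)).measurable
  · rw [abs_of_nonneg (Real.sqrt_nonneg _)]
    exact Real.sqrt_le_sqrt (max_le ((le_abs_self _).trans (SchwartzMap.norm_le_seminorm ℝ f x))
      (apply_nonneg _ _))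

/-- Write `f` as the difference of its positive and negative parts, each the square of a weight that
is bounded and square integrable. Growth and symmetry are recorded along with existence, because
uniqueness later transfers them to `density`. -/
theorem exists_isSmearedDensity {khat : Space d → ℝ} (hk : Integrable khat volume)
    (hk_nonneg : ∀ᵐ p ∂(volume : Measure (Space d)), 0 ≤ khat p) (f : 𝓢(Space d, ℝ)) :
    ∃ R : Module.End ℂ (fockFin d), IsSmearedDensity khat hk f R ∧
      (∃ c, HasLinearGrowth c R) ∧ IsSymmetricOp R := by
  refine Exists.elim (exists_represents_sqrt_max hk hk_nonneg f) fun 𝒦 h𝒦 => ?_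
  refine Exists.elim (exists_represents_sqrt_max hk hk_nonneg (-f)) fun 𝒦' h𝒦' => ?_
  have hg := 𝒦.hasLinearGrowth_smeared.sub 𝒦'.hasLinearGrowth_smeared
  have hf : ∀ x, (f x : ℂ) = (((√(max (f x) 0)) ^ 2 : ℝ) : ℂ) -
      (((√(max ((-f) x) 0)) ^ 2 : ℝ) : ℂ) := by
    intro x
    rw [Real.sq_sqrt (le_max_right _ _), Real.sq_sqrt (le_max_right _ _), neg_apply,
      ← Complex.ofReal_sub]
    congr 1
    rcases le_total 0 (f x) with h | h
    · rw [max_eq_left h, max_eq_right (by linarith), sub_zero]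
    · rw [max_eq_right h, max_eq_left (by linarith)]
      ring
  refine ⟨𝒦.smeared - 𝒦'.smeared, ⟨hg.isFinContinuous, fun G₁ G₂ => ?_⟩, ⟨_, hg⟩, fun u v => ?_⟩
  · have h1 := h𝒦.inner_smeared G₁ G₂
    have h2 := h𝒦'.inner_smeared G₁ G₂
    simp_rw [hf, sub_mul]
    refine ⟨h1.1.sub h2.1, ?_⟩
    rw [integral_sub h1.1 h2.1]
    exact (inner_sub_left _ _ _).trans (congrArg₂ _ h1.2 h2.2)
  · exact (inner_sub_left _ _ _).trans ((congrArg₂ _ (𝒦.inner_smeared_symm u v)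
      (𝒦'.inner_smeared_symm u v)).trans (inner_sub_right _ _ _).symm)

section Density

variable {khat : Space d → ℝ} {hk : Integrable khat volume}

theorem isSmearedDensity_density
    (hk_nonneg : ∀ᵐ p ∂(volume : Measure (Space d)), 0 ≤ khat p) (f : 𝓢(Space d, ℝ)) :
    IsSmearedDensity khat hk f (density khat hk f) :=
  Classical.epsilon_spec ((exists_isSmearedDensity hk hk_nonneg f).imp fun _ h => h.1)

theorem eq_density (hk_nonneg : ∀ᵐ p ∂(volume : Measure (Space d)), 0 ≤ khat p)
    {f : 𝓢(Space d, ℝ)} {R : Module.End ℂ (fockFin d)} (hR : IsSmearedDensity khat hk f R) :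
    R = density khat hk f :=
  hR.unique (isSmearedDensity_density hk_nonneg f)

theorem exists_hasLinearGrowth_density
    (hk_nonneg : ∀ᵐ p ∂(volume : Measure (Space d)), 0 ≤ khat p) (f : 𝓢(Space d, ℝ)) :
    ∃ c, HasLinearGrowth c (density khat hk f) := by
  refine Exists.elim (exists_isSmearedDensity hk hk_nonneg f) fun R hR => ?_
  exact Eq.subst (motive := fun S => ∃ c, HasLinearGrowth c S) (eq_density hk_nonneg hR.1) hR.2.1

theorem isSymmetricOp_density
    (hk_nonneg : ∀ᵐ p ∂(volume : Measure (Space d)), 0 ≤ khat p) (f : 𝓢(Space d, ℝ)) :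
    IsSymmetricOp (density khat hk f) := by
  refine Exists.elim (exists_isSmearedDensity hk hk_nonneg f) fun R hR => ?_
  exact Eq.subst (motive := IsSymmetricOp) (eq_density hk_nonneg hR.1) hR.2.2

end Density

end

/-! ### Factorial bounds on powers, and invariance of the cyclic span -/

section Growth

variable {E : Type*} [NormedAddCommGroup E] [InnerProductSpace ℂ E] {V : Submodule ℂ E}

/-- After `k` applications the particle number bound is `N + 2k`, so the successive norms are of
order `N + 2k + 1`. Their product is factorial, which is exactly what analyticity allows. The
predicate `p N` stands for vanishing from `N` particles on. -/
theorem exists_norm_pow_le {R : Module.End ℂ V} {p : ℕ → V → Prop} {c : ℝ}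
    (hR : ∀ (N : ℕ) (u : V), p N u → p (N + 2) (R u) ∧ ‖(R u : E)‖ ≤ c * ((N : ℝ) + 1) * ‖(u : E)‖)
    {N : ℕ} {u : V} (hu : p N u) :
    ∃ C M : ℝ, 0 ≤ C ∧ 0 ≤ M ∧ ∀ k : ℕ, ‖((R ^ k) u : E)‖ ≤ C * M ^ k * (k.factorial : ℝ) := by
  have h1 : ∀ k : ℕ, p (N + 2 * k) ((R ^ k) u) ∧
      ‖((R ^ k) u : E)‖ ≤ ‖(u : E)‖ * (2 * |c| * ((N : ℝ) + 1)) ^ k * (k.factorial : ℝ) := by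
    intro k
    induction k with
    | zero => simpa using hu
    | succ k ih =>
      rw [pow_succ' R, Module.End.mul_apply]
      have h2 := hR _ _ ih.1
      refine ⟨by rw [mul_add, ← add_assoc]; exact h2.1, h2.2.trans ?_⟩
      -- This separates `N` from `k`: the factor `k + 1` builds the factorial, and the rest is the
      -- constant `M`.
      have h3 : c * (((N + 2 * k : ℕ) : ℝ) + 1) ≤ 2 * |c| * ((N : ℝ) + 1) * ((k : ℝ) + 1) := by
        have h4 : ((N + 2 * k : ℕ) : ℝ) + 1 ≤ 2 * (((N : ℝ) + 1) * ((k : ℝ) + 1)) := by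
          have h5 : (0 : ℝ) ≤ N * k := by positivity
          have h6 : (0 : ℝ) ≤ N := by positivity
          push_cast
          linarith
        have h7 := mul_le_mul (le_abs_self c) h4 (by positivity) (abs_nonneg c)
        linarith
      refine (mul_le_mul h3 ih.2 (norm_nonneg _) (by positivity)).trans_eq ?_
      rw [Nat.factorial_succ]
      push_cast
      ring
  exact ⟨_, _, norm_nonneg _, by positivity, fun k => (h1 k).2⟩

theorem apply_mem_span {R : Module.End ℂ V} {ι : Type*} {φ : ι → V}
    (hφ : ∀ i, ∃ j, R (φ i) = φ j) {u : V}
    (hu : (u : E) ∈ Submodule.span ℂ (Set.range fun i => (φ i : E))) :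
    (R u : E) ∈ Submodule.span ℂ (Set.range fun i => (φ i : E)) := by
  have h1 : Submodule.span ℂ (Set.range fun i => (φ i : E)) =
      (Submodule.span ℂ (Set.range φ)).map V.subtype := by
    rw [Submodule.map_span, ← Set.range_comp]
    rfl
  rw [h1] at hu ⊢
  obtain ⟨u', hu', h⟩ := hu
  obtain rfl : u' = u := Subtype.ext h
  refine Submodule.mem_map_of_mem (f := V.subtype) ?_
  have h2 : Submodule.span ℂ (Set.range φ) ≤ (Submodule.span ℂ (Set.range φ)).comap R := by
    rw [Submodule.span_le]
    rintro _ ⟨i, rfl⟩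
    obtain ⟨j, hj⟩ := hφ i
    exact Submodule.subset_span ⟨j, hj.symm⟩
  exact h2 hu'

end Growth

/-! ### Restriction of a symmetric operator to the closure of an invariant subspace -/

section Restriction

variable {E : Type*} [NormedAddCommGroup E] [InnerProductSpace ℂ E] {V H : Submodule ℂ E}

/-- The restriction of `R` to the subspace `A` of `H`, as an operator in `H`. -/
def restriction (R : Module.End ℂ V) (A : Submodule ℂ H) (hA : ∀ x ∈ A, (x : E) ∈ V)
    (hR : ∀ u : V, ∀ x ∈ A, (x : E) = u → (R u : E) ∈ H) : H →ₗ.[ℂ] H where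
  domain := A
  toFun :=
    { toFun := fun x => ⟨R ⟨x, hA x x.2⟩, hR _ x x.2 rfl⟩
      map_add' := fun x y => by
        apply Subtype.ext
        have h : (⟨((x + y : A) : H), hA _ (x + y).2⟩ : V) =
          ⟨(x : H), hA x x.2⟩ + ⟨(y : H), hA y y.2⟩ := rfl
        dsimp only
        rw [h, map_add]
        rfl
      map_smul' := fun c x => by
        apply Subtype.ext
        have h : (⟨((c • x : A) : H), hA _ (c • x).2⟩ : V) = c • ⟨(x : H), hA x x.2⟩ := rfl
        dsimp only
        rw [h, map_smul]
        rfl }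

variable {R : Module.End ℂ V} {A : Submodule ℂ H} {hA : ∀ x ∈ A, (x : E) ∈ V}
  {hR : ∀ u : V, ∀ x ∈ A, (x : E) = u → (R u : E) ∈ H}

theorem restriction_isFormalAdjoint
    (hsymm : ∀ u v : V, inner ℂ (R u : E) (v : E) = inner ℂ (u : E) (R v : E)) :
    (restriction R A hA hR).IsFormalAdjoint (restriction R A hA hR) := by
  intro x y
  exact hsymm ⟨x, hA x x.2⟩ ⟨y, hA y y.2⟩

theorem restriction_isAnalyticVector
    (hinv : ∀ u : V, ∀ x ∈ A, (x : E) = u → ∃ y ∈ A, (y : E) = R u)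
    (han : ∀ u : V, ∃ C M : ℝ, 0 ≤ C ∧ 0 ≤ M ∧
      ∀ k : ℕ, ‖((R ^ k) u : E)‖ ≤ C * M ^ k * (k.factorial : ℝ)) {x : H} (hx : x ∈ A) :
    IsAnalyticVector (restriction R A hA hR) x := by
  set u : V := ⟨x, hA x hx⟩ with hu
  have h1 : ∀ k : ℕ, ∃ y ∈ A, (y : E) = (R ^ k) u := by
    intro k
    induction k with
    | zero => exact ⟨x, hx, rfl⟩
    | succ k ih =>
      obtain ⟨y, hy, hyu⟩ := ih
      rw [pow_succ', Module.End.mul_apply]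
      exact hinv _ y hy hyu
  choose y hy hyu using h1
  obtain ⟨C, M, hC, hM, hb⟩ := han u
  refine ⟨C, M, fun k => ⟨y k, hy k⟩, hC, hM, Subtype.ext (hyu 0), fun k => Subtype.ext ?_,
    fun k => ?_⟩
  · have h2 : (⟨(y k : E), hA _ (hy k)⟩ : V) = (R ^ k) u := Subtype.ext (hyu k)
    change (y (k + 1) : E) = (R ⟨(y k : E), hA _ (hy k)⟩ : E)
    rw [hyu, h2, pow_succ', Module.End.mul_apply]
  · have h2 := hb k
    rw [← hyu] at h2
    exact h2

variable {W : Submodule ℂ E}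

theorem dense_comap_subtype (hH : H = W.topologicalClosure) :
    Dense ((W.comap H.subtype : Submodule ℂ H) : Set H) := by
  subst hH
  intro x
  rw [Metric.mem_closure_iff]
  intro ε hε
  obtain ⟨y, hy, hxy⟩ := Metric.mem_closure_iff.mp
    ((Submodule.topologicalClosure_coe W) ▸ x.2 : (x : E) ∈ closure (W : Set E)) ε hε
  exact ⟨⟨y, W.le_topologicalClosure hy⟩, hy, hxy⟩

/-- Let `R` be a symmetric operator on the subspace `V` of a Hilbert space, all of whose vectors
are analytic, and let `H` be the closure of a subspace of `V` that is invariant under `R`. Then `R`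
maps `H ∩ V` into `H`, and it is essentially self-adjoint on `H ∩ V`. -/
theorem exists_essentiallySelfAdjoint_restriction [CompleteSpace H]
    (hH : H = W.topologicalClosure) (hWV : W ≤ V) (hRW : ∀ u : V, (u : E) ∈ W → (R u : E) ∈ W)
    (hV : ∀ z : E, (∀ w : V, inner ℂ z (w : E) = 0) → z = 0)
    (hsymm : ∀ u v : V, inner ℂ (R u : E) (v : E) = inner ℂ (u : E) (R v : E))
    (han : ∀ u : V, ∃ C M : ℝ, 0 ≤ C ∧ 0 ≤ M ∧
      ∀ k : ℕ, ‖((R ^ k) u : E)‖ ≤ C * M ^ k * (k.factorial : ℝ)) :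
    ∃ T : H →ₗ.[ℂ] H, T.domain = V.comap H.subtype ∧
      (∀ (u : T.domain) (v : V), ((u : H) : E) = v → ((T u : H) : E) = R v) ∧
      IsEssentiallySelfAdjoint T := by
  have hWH : W ≤ H := hH ▸ W.le_topologicalClosure
  have hd := dense_comap_subtype hH
  have hR0 : ∀ u : V, ∀ x ∈ W.comap H.subtype, (x : E) = u → (R u : E) ∈ H :=
    fun u x hx hxu => hWH (hRW u (by rw [← hxu]; exact hx))
  set S := restriction R (W.comap H.subtype) (fun x hx => hWV hx) hR0
  have hSsymm : S.IsFormalAdjoint S := restriction_isFormalAdjoint hsymm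
  have hSan : ∀ x ∈ ((W.comap H.subtype : Submodule ℂ H) : Set H), IsAnalyticVector S x :=
    fun x hx => restriction_isAnalyticVector (A := W.comap H.subtype)
      (fun u x hx hxu => ⟨⟨R u, hR0 u x hx hxu⟩,
        hRW u (by rw [← hxu]; exact hx), rfl⟩) han hx
  have hRH : ∀ u : V, ∀ x ∈ V.comap H.subtype, (x : E) = u → (R u : E) ∈ H := by
    intro u x _ hxu
    -- The projection is invisible when paired with vectors of `W`, so symmetry places this pair in
    -- the graph of the adjoint of `S`. The vectors of `W` are analytic and dense in `H`, hence it
    -- lies in the closure of the graph of `S`.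
    have h1 : (x, H.orthogonalProjectionOnto (R u : E)) ∈ S.graph.topologicalClosure := by
      refine mem_closure_graph_of_adjoint hSsymm hd hSan fun w => ?_
      have h2 := hsymm u ⟨((w : H) : E), hWV w.2⟩
      have h3 := H.inner_orthogonalProjectionOnto_eq_of_mem_right (w : H) (R u : E)
      rw [Submodule.coe_inner, hxu, h3]
      exact h2.symm
    -- The identity `⟨p₂, w⟩ = ⟨p₁, R w⟩` holds on the graph of `S` for every `w` in `V`, not only
    -- in `W`, and passes to the closure. Applied to the pair above it shows that `R u` and its
    -- projection have the same pairings with `V`, which separates points.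
    have h3 : (R u : E) = H.orthogonalProjectionOnto (R u : E) := by
      refine sub_eq_zero.mp (hV _ fun w => ?_)
      have hc : IsClosed {p : H × H | inner ℂ (p.2 : E) (w : E) = inner ℂ (p.1 : E) (R w : E)} :=
        isClosed_eq (by fun_prop) (by fun_prop)
      have h4 := closure_minimal (s := (S.graph : Set (H × H))) (fun p hp => by
        obtain ⟨p1, p2⟩ := p
        obtain ⟨y, rfl, rfl⟩ := (LinearPMap.mem_graph_iff S).mp hp
        exact hsymm ⟨((y : H) : E), hWV y.2⟩ w) hc h1
      have h5 : inner ℂ ((H.orthogonalProjectionOnto (R u : E) : H) : E) (w : E) =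
        inner ℂ (x : E) (R w : E) := h4
      rw [inner_sub_left, h5, hsymm, hxu, sub_self]
    rw [h3]
    exact Subtype.mem _
  refine ⟨restriction R (V.comap H.subtype) (fun x hx => hx) hRH, rfl, fun u v huv => ?_, ?_⟩
  · exact congrArg (fun z : V => (R z : E)) (Subtype.ext huv)
  -- Vectors of `W` already form a dense set of analytic vectors; the invariance just proved is what
  -- makes the larger domain admissible.
  · refine isEssentiallySelfAdjoint_of_analyticVectors (restriction_isFormalAdjoint hsymm)
      (hd.mono fun x hx => hWV hx) hd fun x hx => ?_
    exact restriction_isAnalyticVector (A := V.comap H.subtype)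
      (fun u x hx hxu => ⟨⟨R u, hRH u x hx hxu⟩, (R u).2, rfl⟩)
      han (hWV hx)

end Restriction

/-! ### Application to the density operators -/

section Density

variable {d : ℕ} {khat : Space d → ℝ} {hk : Integrable khat volume}

theorem exists_norm_density_pow_le
    (hk_nonneg : ∀ᵐ p ∂(volume : Measure (Space d)), 0 ≤ khat p) (f : 𝓢(Space d, ℝ))
    (u : fockFin d) : ∃ C M : ℝ, 0 ≤ C ∧ 0 ≤ M ∧
      ∀ k : ℕ, ‖((density khat hk f ^ k) u : Fock d)‖ ≤ C * M ^ k * (k.factorial : ℝ) := by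
  refine Exists.elim (exists_hasLinearGrowth_density (hk := hk) hk_nonneg f) fun c hc => ?_
  refine Exists.elim u.2 fun N hN => ?_
  exact exists_norm_pow_le (V := fockFin d) (R := density khat hk f)
    (p := fun N v => ∀ n, N ≤ n → (v : Fock d) n = 0) hc hN

theorem eq_zero_of_inner_fockFin {z : Fock d} (hz : ∀ w : fockFin d, inner ℂ z (w : Fock d) = 0) :
    z = 0 :=
  eq_zero_of_inner_toFock fun G => hz G.toFock

end Density

end FermiGas

end

theorem lemma3p3 (d : ℕ) (khat : FermiGas.Space d → ℝ) (hk : Integrable khat volume)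
    (hk_nonneg : ∀ᵐ p ∂(volume : Measure (FermiGas.Space d)), 0 ≤ khat p)
    (hk_le_one : ∀ᵐ p ∂(volume : Measure (FermiGas.Space d)), khat p ≤ 1)
    (f : 𝓢(FermiGas.Space d, ℝ)) :
    (∃! R, FermiGas.IsSmearedDensity khat hk f R) ∧
    FermiGas.IsSmearedDensity khat hk f (FermiGas.density khat hk f) ∧
    ∃ T : FermiGas.cyclicSpace khat hk →ₗ.[ℂ] FermiGas.cyclicSpace khat hk,
      T.domain = FermiGas.cyclicFin khat hk ∧
      (∀ (u : T.domain) (v : FermiGas.fockFin d),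
        ((u : FermiGas.cyclicSpace khat hk) : FermiGas.Fock d) = v →
          ((T u : FermiGas.cyclicSpace khat hk) : FermiGas.Fock d) =
            FermiGas.density khat hk f v) ∧
      FermiGas.IsEssentiallySelfAdjoint (F := FermiGas.cyclicSpace khat hk) T := by
  refine ⟨⟨_, FermiGas.isSmearedDensity_density hk_nonneg f,
    fun R hR => FermiGas.eq_density hk_nonneg hR⟩,
    FermiGas.isSmearedDensity_density hk_nonneg f, ?_⟩
  -- Here `W` is the span of the vectors indexed by lists of test functions. It is invariant because
  -- `ρ(f)` prepends `f` to the list, and the empty list gives the vacuum.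
  refine FermiGas.exists_essentiallySelfAdjoint_restriction (H := FermiGas.cyclicSpace khat hk) rfl
    ?_ (fun u hu => FermiGas.apply_mem_span (fun l => ⟨f :: l, rfl⟩) hu)
    (fun z hz => FermiGas.eq_zero_of_inner_fockFin hz)
    (FermiGas.isSymmetricOp_density hk_nonneg f)
    (FermiGas.exists_norm_density_pow_le hk_nonneg f)
  rw [Submodule.span_le]
  exact Set.range_subset_iff.mpr fun l => Subtype.mem _
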